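/- **Setting.** Let $\mathcal X$ be a measurable space that also carries a topology, $\mathcal Y=\{-1,1\}$, $\rho$ a probability measure on $\mathcal X\times\mathcal Y$ with marginal $\rho_{\mathcal X}$ and conditional probability $\rho(1|x)$, and $\mathcal H$ a real reproducing kernel Hilbert space of functions on $\mathcal X$ with kernel $k$, such that $x\mapsto k(x,\cdot)\in\mathcal H$ is strongly measurable. Let $\phi:\mathbb R\to[0,\infty)$, $l(\zeta,y)=\phi(y\zeta)$, $\mathcal L(g)=\mathbb E_{(X,Y)\sim\rho}[l(g(X),Y)]$ and, for $\lambda>0$, $\mathcal L_\lambda(g)=\mathcal L(g)+\frac\lambda2\|g\|_{\mathcal H}^2$. Let $\mathcal R(g)=\mathbb P_{(X,Y)\sim\rho}[\mathrm{sgn}(g(X))\ne Y]$ (with $\mathrm{sgn}(0)=0$) be the classification error. For $\mu\in(0,1)$ put $h_*(\mu)=\arg\min_{h\in\mathbb R}\{\mu\phi(h)+(1-\mu)\phi(-h)\}$, $l_*(\mu)=\min_{h\in\mathbb R}\{\mu\phi(h)+(1-\mu)\phi(-h)\}$ and $d_{l_*}(\eta_1,\eta_2)=-l_*(\eta_2)+l_*(\eta_1)+l_*'(\eta_1)(\eta_2-\eta_1)$.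 A Bayes rule for $\mathcal L$ is a measurable function $\mathcal X\to\mathbb R$ minimizing $\mathcal L$ over all measurable functions. **Assumptions.** (A1) $\phi$ is differentiable and convex, and $|\partial_\zeta l(\zeta,y)|\le M$ for all $\zeta,y$, where $M>0$. (A2) $\mathrm{supp}(\rho_{\mathcal X})=\mathcal X$, and $k(x,x)\le R^2$ for all $x\in\mathcal X$, where $R>0$. (A3) $\delta\in(0,1/2)$ and $|\rho(1|x)-\frac12|>\delta$ for $\rho_{\mathcal X}$-almost every $x$. (A4) $\rho(1|x)\in(0,1)$ for $\rho_{\mathcal X}$-almost every $x$; $h_*$ is well defined (the minimizer exists and is unique), differentiable, monotonically increasing and injective on $(0,1)$; and $\mathrm{sgn}(\mu-\frac12)=\mathrm{sgn}(h_*(\mu))$ for all $\mu\in(0,1)$. (A5) For $\eta_1,\eta_2\in(0,1)$, $d_{l_*}(\eta_1,\eta_2)=0$ if and only if $\eta_1=\eta_2$; and there is $g_*\in\mathcal H$ that is a Bayes rule for $\mathcal L$ and to which every Bayes rule for $\mathcal L$ is equal $\rho_{\mathcal X}$-almost everywhere. Put $m(\delta)=\max\{h_*(\tfrac12+\delta),|h_*(\tfrac12-\delta)|\}$.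 **Theorem.** Under (A1)–(A5) there is $\lambda_0>0$ such that for every $\lambda\in(0,\lambda_0]$ the following holds. The functional $\mathcal L_\lambda$ has a unique minimizer $g_\lambda$ over $\mathcal H$. Let $\gamma>0$, $\eta_t=\frac{2}{\lambda(\gamma+t)}$ with $\eta_1\le\frac1{2\lambda}$, let $g_1\in\mathcal H$ with $\|g_1\|_{\mathcal H}\le(2\eta_1+\frac1\lambda)MR$, and let $T\ge0$ be an integer such that $$\max\left\{\frac{36M^2R^2}{\lambda^2(2\gamma+T)},\ \frac{\gamma(\gamma-1)\|g_1-g_\lambda\|_{\mathcal H}^2}{(2\gamma+T)(T+1)}\right\}\le\frac{m(\delta)^2}{32R^2}.$$ Let $(X_t,Y_t)$, $t\ge1$, be i.i.d. with law $\rho$, let $g_{t+1}=g_t-\eta_t\big(\partial_\zeta l(g_t(X_t),Y_t)\,k(X_t,\cdot)+\lambda g_t\big)$, and let $$\overline g_{T+1}=\sum_{t=1}^{T+1}\alpha_t g_t,\qquad \alpha_t=\frac{2(\gamma+t-1)}{(2\gamma+T)(T+1)}.$$ Then $\mathcal R(\overline g_{T+1})-\mathcal R(\mathbb E[Y|x])$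 is integrable, where $\mathbb E[Y|x]=2\rho(1|x)-1$ is viewed as a function of $x$, and $$\mathbb E\big[\mathcal R(\overline g_{T+1})-\mathcal R(\mathbb E[Y|x])\big]\le 2\exp\left(-\frac{m(\delta)^2\lambda^2(2\gamma+T)}{2^{10}\cdot 9\,M^2R^4}\right).$$ -/

import Mathlib

open MeasureTheory ProbabilityTheory

noncomputable section

/-- The set of binary labels `{-1, 1}`. -/
abbrev Label : Type := ({-1, 1} : Set ℝ)

/-- The label `1`. -/
def Label.one : Label := ⟨1, by simp⟩

instance : Nonempty Label := ⟨Label.one⟩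

/-! ### Loss, link function, Bregman divergence -/

/-- The loss `l(ζ, y) = φ(y ζ)`. -/
def loss (φ : ℝ → ℝ) (ζ : ℝ) (y : Label) : ℝ := φ ((y : ℝ) * ζ)

/-- The partial derivative `∂_ζ l(ζ, y)`. -/
def dloss (φ : ℝ → ℝ) (ζ : ℝ) (y : Label) : ℝ := deriv (fun ζ' => loss φ ζ' y) ζ

/-- `μ φ(h) + (1 - μ) φ(-h)`. -/
def condRisk (φ : ℝ → ℝ) (μ h : ℝ) : ℝ := μ * φ h + (1 - μ) * φ (-h)

/-- The link function is well defined: for every `μ ∈ (0,1)` there is exactly one minimizer of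
`h ↦ μ φ(h) + (1 - μ) φ(-h)`. -/
def LinkWellDefined (φ : ℝ → ℝ) : Prop :=
  ∀ μ ∈ Set.Ioo (0 : ℝ) 1, ∃! h : ℝ, ∀ h' : ℝ, condRisk φ μ h ≤ condRisk φ μ h'

/-- The link function `h_*(μ) = argmin_h (μ φ(h) + (1 - μ) φ(-h))`
(meaningful for `μ ∈ (0,1)` when `LinkWellDefined φ`). -/
def linkFun (φ : ℝ → ℝ) (μ : ℝ) : ℝ :=
  Classical.epsilon fun h : ℝ => ∀ h' : ℝ, condRisk φ μ h ≤ condRisk φ μ h'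

/-- The value `l_*(μ) = min_h (μ φ(h) + (1 - μ) φ(-h))`. -/
def lstar (φ : ℝ → ℝ) (μ : ℝ) : ℝ := ⨅ h : ℝ, condRisk φ μ h

/-- The Bregman divergence
`d_{l_*}(η₁, η₂) = -l_*(η₂) + l_*(η₁) + l_*'(η₁) (η₂ - η₁)`. -/
def bregman (φ : ℝ → ℝ) (η₁ η₂ : ℝ) : ℝ :=
  -lstar φ η₂ + lstar φ η₁ + deriv (lstar φ) η₁ * (η₂ - η₁)

/-- `m(δ) = max {h_*(1/2 + δ), |h_*(1/2 - δ)|}`. -/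
def margin (φ : ℝ → ℝ) (δ : ℝ) : ℝ :=
  max (linkFun φ (1 / 2 + δ)) |linkFun φ (1 / 2 - δ)|

/-! ### Risks -/

section Risk

variable {X : Type*} [MeasurableSpace X]

/-- The conditional label probability `ρ(1 | x)`. -/
def condProb (ρ : Measure (X × Label)) [IsFiniteMeasure ρ] (x : X) : ℝ :=
  (ρ.condKernel x).real {Label.one}

/-- The conditional mean `E[Y | x]`. -/
def condMean (ρ : Measure (X × Label)) [IsFiniteMeasure ρ] (x : X) : ℝ :=
  ∫ y, (y : ℝ) ∂(ρ.condKernel x)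

/-- The `0`-`1` error function `I`. -/
def zeroOne (y y' : ℝ) : ℝ := if y ≠ y' then 1 else 0

/-- The expected classification error `R(g) = E[I(sgn(g(X)), Y)]`. -/
def classError (ρ : Measure (X × Label)) (g : X → ℝ) : ℝ :=
  ∫ z, zeroOne (Real.sign (g z.1)) (z.2 : ℝ) ∂ρ

/-- The expected risk `E[l(g(X), Y)] ∈ [0, ∞]` of an arbitrary measurable function
(for a non-negative loss). -/
def extRisk (ρ : Measure (X × Label)) (φ : ℝ → ℝ) (g : X → ℝ) : ENNReal :=
  ∫⁻ z, ENNReal.ofReal (loss φ (g z.1) z.2) ∂ρ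

/-- `g` is a Bayes rule for the expected risk: it minimizes it over all measurable functions. -/
def IsBayesRule (ρ : Measure (X × Label)) (φ : ℝ → ℝ) (g : X → ℝ) : Prop :=
  Measurable g ∧ ∀ f : X → ℝ, Measurable f → extRisk ρ φ g ≤ extRisk ρ φ f

end Risk

/-! ### The reproducing kernel Hilbert space and stochastic gradient descent -/

section SGD

variable {X H : Type*} [NormedAddCommGroup H] [InnerProductSpace ℝ H] [CompleteSpace H]
  [RKHS ℝ H X ℝ]

/-- The real-valued reproducing kernel `k(x, x')` of `H`. -/
def kern (H : Type*) {X : Type*} [NormedAddCommGroup H] [InnerProductSpace ℝ H]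
    [CompleteSpace H] [RKHS ℝ H X ℝ] (x x' : X) : ℝ := RKHS.kernel H x x' 1

/-- The function `k(x, ·)` as an element of `H`. -/
def feature (H : Type*) {X : Type*} [NormedAddCommGroup H] [InnerProductSpace ℝ H]
    [CompleteSpace H] [RKHS ℝ H X ℝ] (x : X) : H := RKHS.kerFun H x 1

/-- The regularized expected risk `L_λ(g) = E[l(g(X), Y)] + λ/2 ‖g‖²` on `H`. -/
def regRisk [MeasurableSpace X] (ρ : Measure (X × Label)) (φ : ℝ → ℝ) (lam : ℝ) (g : H) : ℝ :=
  (∫ z, loss φ (g z.1) z.2 ∂ρ) + lam / 2 * ‖g‖ ^ 2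

/-- The stochastic gradient `G_λ(g, (x, y)) = ∂_ζ l(g(x), y) k(x, ·) + λ g`. -/
def stochGrad (φ : ℝ → ℝ) (lam : ℝ) (g : H) (z : X × Label) : H :=
  dloss φ (g z.1) z.2 • feature H z.1 + lam • g

/-- Stochastic gradient descent with learning rates `η₁, η₂, …` along the samples `z₁, z₂, …`:
the value at `n` is the iterate `g_{n+1}`, where `g_{t+1} = g_t - η_t G_λ(g_t, z_t)`. -/
def sgd (φ : ℝ → ℝ) (lam : ℝ) (η : ℕ → ℝ) (g₁ : H) (z : ℕ → X × Label) : ℕ → H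
  | 0 => g₁
  | n + 1 => sgd φ lam η g₁ z n - η (n + 1) • stochGrad φ lam (sgd φ lam η g₁ z n) (z (n + 1))

/-- The weighted average `∑_{t=1}^{T+1} α_t g_t` of the iterates. -/
def avgSgd (φ : ℝ → ℝ) (lam : ℝ) (η α : ℕ → ℝ) (g₁ : H) (T : ℕ) (z : ℕ → X × Label) : H :=
  ∑ n ∈ Finset.range (T + 1), α (n + 1) • sgd φ lam η g₁ z n

/-- The learning rate `η_t = 2 / (λ (γ + t))`. -/
def stepSize (lam γ : ℝ) (t : ℕ) : ℝ := 2 / (lam * (γ + t))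

/-- The averaging weight `α_t = 2 (γ + t - 1) / ((2γ + T)(T + 1))`. -/
def avgWeight (γ : ℝ) (T t : ℕ) : ℝ := 2 * (γ + t - 1) / ((2 * γ + T) * (T + 1))

end SGD

end

noncomputable section

/-! ### Tikhonov regularization of a convex functional on a Hilbert space. -/

section Tikhonov

open Filter Topology

variable {H : Type*} [NormedAddCommGroup H] [InnerProductSpace ℝ H]

/-! A small RKHS distance to the right function already forces the Bayes classifier. Conditioning on
`x` shows that a finite-risk Bayes rule is a.e. the link function of the conditional probability
(`IsBayesRule.ae_eq_linkFun`). The noise condition, monotonicity of the link and its odd symmetry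
about `1/2` keep this function at least `m(δ)` away from zero (`margin_le_abs_linkFun`), with the
Bayes sign. Evaluation is `R`-Lipschitz, so every `g` within `m(δ)/R` of such a rule `q ∈ H` has
zero excess error.

The regularized minimizers converge in norm to some such `q` as `λ → 0`
(`exists_tendsto_regularized_minimizer`), which supplies `λ₀`: below it, the minimizer `p` is within
`m(δ)/(2R)` of `q`. The excess error is then at most the indicator that averaged SGD is at least
`m(δ)/(2R)` away from `p`.

The probability of that event comes from an exponential moment
(`measureReal_le_norm_avgSgd_sub_le`). Strong convexity makes a weighted squared distance to `p`
decrease, up to a bounded drift and a centred noise term. By Hoeffding's lemma, the noise costs a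
multiple of the same potential (`lintegral_exp_potential_step_le`). Slowly decreasing exponential
parameters absorb this cost, while the decrease is accumulated into a sum that dominates the squared
distance of the average by Jensen. Markov's inequality gives the tail. -/

theorem norm_sq_convexComb (p g : H) (s : ℝ) :
    ‖(1 - s) • p + s • g‖ ^ 2
      = (1 - s) * ‖p‖ ^ 2 + s * ‖g‖ ^ 2 - s * (1 - s) * ‖g - p‖ ^ 2 := by
  rw [norm_add_sq_real, norm_sub_sq_real, norm_smul, norm_smul, real_inner_smul_left,
    real_inner_smul_right, mul_pow, mul_pow, Real.norm_eq_abs, Real.norm_eq_abs, sq_abs, sq_abs,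
    real_inner_comm p g]
  ring

/-- A convex function plus `lam / 2 * ‖·‖ ^ 2` satisfies the strong convexity inequality. -/
theorem regularized_convexComb_le {L : H → ℝ} (hL : ConvexOn ℝ Set.univ L) (lam : ℝ) (p g : H)
    {s : ℝ} (hs0 : 0 ≤ s) (hs1 : s ≤ 1) :
    L ((1 - s) • p + s • g) + lam / 2 * ‖(1 - s) • p + s • g‖ ^ 2
      ≤ (1 - s) * (L p + lam / 2 * ‖p‖ ^ 2) + s * (L g + lam / 2 * ‖g‖ ^ 2)
        - lam / 2 * (s * (1 - s)) * ‖g - p‖ ^ 2 := by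
  have h := hL.2 (Set.mem_univ p) (Set.mem_univ g) (sub_nonneg.2 hs1) hs0 (by ring)
  rw [norm_sq_convexComb]
  simp only [smul_eq_mul] at h
  linarith

/-- Minimality at `(1 - s) • p + s • g` combined with strong convexity; divide by `s` and let `s →
0`. -/
theorem regularized_quadratic_growth {L : H → ℝ} (hL : ConvexOn ℝ Set.univ L) {lam : ℝ} {p : H}
    (hp : ∀ g, L p + lam / 2 * ‖p‖ ^ 2 ≤ L g + lam / 2 * ‖g‖ ^ 2) (g : H) :
    L p + lam / 2 * ‖p‖ ^ 2 + lam / 2 * ‖g - p‖ ^ 2 ≤ L g + lam / 2 * ‖g‖ ^ 2 := by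
  have key : ∀ s : ℝ, 0 < s → s < 1 →
      L p + lam / 2 * ‖p‖ ^ 2 + lam / 2 * (1 - s) * ‖g - p‖ ^ 2 ≤ L g + lam / 2 * ‖g‖ ^ 2 := by
    intro s hs0 hs1
    have h1 := regularized_convexComb_le hL lam p g hs0.le hs1.le
    have h2 := hp ((1 - s) • p + s • g)
    refine le_of_mul_le_mul_left ?_ hs0
    linarith
  have hlim : Tendsto (fun s : ℝ => L p + lam / 2 * ‖p‖ ^ 2 + lam / 2 * (1 - s) * ‖g - p‖ ^ 2)
      (𝓝[>] 0) (𝓝 (L p + lam / 2 * ‖p‖ ^ 2 + lam / 2 * (1 - 0) * ‖g - p‖ ^ 2)) := by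
    refine tendsto_nhdsWithin_of_tendsto_nhds (Continuous.tendsto ?_ 0)
    fun_prop
  rw [sub_zero, mul_one] at hlim
  refine le_of_tendsto hlim ?_
  filter_upwards [Ioo_mem_nhdsGT (zero_lt_one' ℝ)] with s hs using key s hs.1 hs.2

theorem exists_regularized_minimizer [CompleteSpace H] {L : H → ℝ} (hL : ConvexOn ℝ Set.univ L)
    (hc : Continuous L) (h0 : ∀ g, 0 ≤ L g) {lam : ℝ} (hlam : 0 < lam) :
    ∃ p, ∀ g, L p + lam / 2 * ‖p‖ ^ 2 ≤ L g + lam / 2 * ‖g‖ ^ 2 := by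
  set J : H → ℝ := fun g => L g + lam / 2 * ‖g‖ ^ 2 with hJ
  have hJc : Continuous J := by fun_prop
  have hbdd : BddBelow (Set.range J) := by
    refine ⟨0, ?_⟩
    rintro _ ⟨g, rfl⟩
    exact add_nonneg (h0 g) (by positivity)
  have hex : ∀ n : ℕ, ∃ u, J u < (⨅ g, J g) + 1 / ((n : ℝ) + 1) := fun n =>
    exists_lt_of_ciInf_lt (lt_add_of_pos_right _ (by positivity))
  choose u hu using hex
  have hcauchy : CauchySeq u := by
    -- Strong convexity at the midpoint bounds `lam / 8` times the squared distance by the mean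
    -- excess of the two terms over the infimum; hence the factor `8 / lam`.
    refine cauchySeq_of_le_tendsto_0' (fun n : ℕ => √(8 / lam * (1 / ((n : ℝ) + 1)))) ?_ ?_
    · intro n k hnk
      refine Real.le_sqrt_of_sq_le ?_
      have h1 := regularized_convexComb_le hL lam (u n) (u k) (s := 1 / 2) (by norm_num)
        (by norm_num)
      have h2 : (⨅ g, J g) ≤ J ((1 - (1 / 2 : ℝ)) • u n + (1 / 2 : ℝ) • u k) := ciInf_le hbdd _
      have h3 := hu n
      have h4 := hu k
      have h5 : 1 / ((k : ℝ) + 1) ≤ 1 / ((n : ℝ) + 1) := by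
        have : (n : ℝ) ≤ k := by exact_mod_cast hnk
        gcongr
      simp only [hJ] at h2 h3 h4
      rw [dist_comm, dist_eq_norm, div_mul_eq_mul_div, le_div_iff₀ hlam]
      linarith
    · have : Tendsto (fun n : ℕ => √(8 / lam * (1 / ((n : ℝ) + 1)))) atTop
          (𝓝 (√(8 / lam * 0))) :=
        (tendsto_one_div_add_atTop_nhds_zero_nat.const_mul _).sqrt
      simpa using this
  obtain ⟨p, hp⟩ := cauchySeq_tendsto_of_complete hcauchy
  refine ⟨p, fun g => ?_⟩
  have h1 : Tendsto (fun n => J (u n)) atTop (𝓝 (J p)) := (hJc.tendsto p).comp hp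
  have h2 : Tendsto (fun n : ℕ => (⨅ g, J g) + 1 / ((n : ℝ) + 1)) atTop (𝓝 ((⨅ g, J g) + 0)) :=
    tendsto_one_div_add_atTop_nhds_zero_nat.const_add _
  rw [add_zero] at h2
  exact (le_of_tendsto_of_tendsto' h1 h2 fun n => (hu n).le).trans (ciInf_le hbdd g)

/-- Adding the two quadratic growth inequalities cancels `L` and gives `(a + b) d ≤ (b - a)(‖p‖² -
‖q‖²)` for the squared distance `d`. So the norm grows as the parameter shrinks, and its growth
controls the displacement. -/
theorem norm_sub_sq_le_of_regularized_minimizers {L : H → ℝ} (hL : ConvexOn ℝ Set.univ L)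
    {a b : ℝ} (ha : 0 < a) (hab : a ≤ b) {p q : H}
    (hp : ∀ g, L p + a / 2 * ‖p‖ ^ 2 ≤ L g + a / 2 * ‖g‖ ^ 2)
    (hq : ∀ g, L q + b / 2 * ‖q‖ ^ 2 ≤ L g + b / 2 * ‖g‖ ^ 2) :
    ‖p - q‖ ^ 2 ≤ ‖p‖ ^ 2 - ‖q‖ ^ 2 := by
  have h1 := regularized_quadratic_growth hL hp q
  have h2 := regularized_quadratic_growth hL hq p
  rw [norm_sub_rev q p] at h1
  rcases hab.eq_or_lt with rfl | hlt
  · have h3 : ‖p - q‖ ^ 2 = 0 := by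
      have := sq_nonneg ‖p - q‖
      nlinarith
    have h4 : p = q := by simpa [sub_eq_zero] using h3
    simp [h4]
  · refine le_of_mul_le_mul_left ?_ (sub_pos.2 hlt)
    have : 0 ≤ a * ‖p - q‖ ^ 2 := by positivity
    linarith

/-- Tikhonov regularization converges in norm to a minimizer as the parameter tends to `0`. -/
theorem exists_tendsto_regularized_minimizer [CompleteSpace H] {L : H → ℝ}
    (hL : ConvexOn ℝ Set.univ L) (hc : Continuous L) {g₀ : H} (hg₀ : ∀ g, L g₀ ≤ L g) {p : ℝ → H}
    (hp : ∀ lam, 0 < lam → ∀ g, L (p lam) + lam / 2 * ‖p lam‖ ^ 2 ≤ L g + lam / 2 * ‖g‖ ^ 2) :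
    ∃ q, Tendsto p (𝓝[>] 0) (𝓝 q) ∧ L q ≤ L g₀ := by
  have hbound : ∀ lam, 0 < lam → ‖p lam‖ ^ 2 ≤ ‖g₀‖ ^ 2 := by
    intro lam hlam
    have h1 := hp lam hlam g₀
    have h2 := hg₀ (p lam)
    refine le_of_mul_le_mul_left ?_ (half_pos hlam)
    linarith
  set S : Set ℝ := (fun lam => ‖p lam‖ ^ 2) '' Set.Ioi 0 with hS
  have hSbdd : BddAbove S := by
    refine ⟨‖g₀‖ ^ 2, ?_⟩
    rintro _ ⟨lam, hlam, rfl⟩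
    exact hbound lam hlam
  have hSne : S.Nonempty := ⟨_, 1, zero_lt_one' ℝ, rfl⟩
  have hcauchy : Cauchy (map p (𝓝[>] 0)) := by
    rw [Metric.cauchy_iff]
    refine ⟨inferInstance, fun ε hε => ?_⟩
    -- Squared norms are bounded and monotone in the parameter, so beyond `c` less than `ε ^ 2` of
    -- growth remains, and displacements are below `ε`.
    obtain ⟨_, ⟨c, hc0, rfl⟩, hclt⟩ := exists_lt_of_lt_csSup hSne
      (show sSup S - ε ^ 2 < sSup S by linarith [pow_pos hε 2])
    have hdist : ∀ a b, 0 < a → a ≤ b → b ≤ c → dist (p a) (p b) < ε := by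
      intro a b ha hab hbc
      have hb := ha.trans_le hab
      have h1 := norm_sub_sq_le_of_regularized_minimizers hL ha hab (hp a ha) (hp b hb)
      have h2 := norm_sub_sq_le_of_regularized_minimizers hL hb hbc (hp b hb) (hp c hc0)
      have h3 : ‖p a‖ ^ 2 ≤ sSup S := le_csSup hSbdd ⟨a, ha, rfl⟩
      rw [dist_eq_norm]
      refine lt_of_pow_lt_pow_left₀ 2 hε.le ?_
      have h4 := sq_nonneg ‖p b - p c‖
      simp only at hclt
      linarith
    refine ⟨p '' Set.Ioc 0 c, image_mem_map (Ioc_mem_nhdsGT hc0), ?_⟩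
    rintro _ ⟨a, ha, rfl⟩ _ ⟨b, hb, rfl⟩
    rcases le_total a b with hab | hab
    · exact hdist a b ha.1 hab hb.2
    · rw [dist_comm]
      exact hdist b a hb.1 hab ha.2
  obtain ⟨q, hq⟩ := CompleteSpace.complete hcauchy
  have hq' : Tendsto p (𝓝[>] 0) (𝓝 q) := hq
  refine ⟨q, hq', ?_⟩
  have h1 : Tendsto (fun lam => L (p lam)) (𝓝[>] 0) (𝓝 (L q)) := (hc.tendsto q).comp hq'
  have h2 : Tendsto (fun lam : ℝ => L g₀ + lam / 2 * ‖g₀‖ ^ 2) (𝓝[>] 0)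
      (𝓝 (L g₀ + 0 / 2 * ‖g₀‖ ^ 2)) := by
    refine tendsto_nhdsWithin_of_tendsto_nhds (Continuous.tendsto ?_ 0)
    fun_prop
  rw [zero_div, zero_mul, add_zero] at h2
  refine le_of_tendsto_of_tendsto h1 h2 ?_
  filter_upwards [self_mem_nhdsWithin] with lam hlam
  have h3 := hp lam hlam g₀
  have h4 : 0 ≤ lam / 2 * ‖p lam‖ ^ 2 := mul_nonneg (half_pos hlam).le (sq_nonneg _)
  linarith

end Tikhonov

/-! ### Convexity, Lipschitz bounds and measurability of the loss. -/

section Loss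

theorem Label.coe_eq_neg_one_or_one (y : Label) : (y : ℝ) = -1 ∨ (y : ℝ) = 1 :=
  y.2

variable {φ : ℝ → ℝ}

theorem dloss_eq (hφ : Differentiable ℝ φ) (ζ : ℝ) (y : Label) :
    dloss φ ζ y = y * deriv φ (y * ζ) := by
  have h : HasDerivAt (fun ζ' : ℝ => φ (y * ζ')) (deriv φ (y * ζ) * (y * 1)) ζ :=
    (hφ _).hasDerivAt.comp ζ ((hasDerivAt_id ζ).const_mul (y : ℝ))
  rw [dloss]
  simp only [loss]
  rw [h.deriv]
  ring

theorem le_of_convexOn_of_deriv (hφ : Differentiable ℝ φ) (hc : ConvexOn ℝ Set.univ φ) (a b : ℝ) :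
    φ a + deriv φ a * (b - a) ≤ φ b := by
  rcases lt_trichotomy a b with h | rfl | h
  · have := hc.le_slope_of_hasDerivAt (Set.mem_univ a) (Set.mem_univ b) h (hφ a).hasDerivAt
    rw [slope_def_field, le_div_iff₀ (sub_pos.2 h)] at this
    linarith
  · simp
  · have := hc.slope_le_of_hasDerivAt (Set.mem_univ b) (Set.mem_univ a) h (hφ a).hasDerivAt
    rw [slope_def_field, div_le_iff₀ (sub_pos.2 h)] at this
    linarith

theorem loss_add_dloss_le (hφ : Differentiable ℝ φ) (hc : ConvexOn ℝ Set.univ φ) (a b : ℝ)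
    (y : Label) : loss φ a y + dloss φ a y * (b - a) ≤ loss φ b y := by
  have := le_of_convexOn_of_deriv hφ hc (y * a) (y * b)
  rw [dloss_eq hφ]
  simp only [loss]
  linarith

theorem loss_convexComb_le (hc : ConvexOn ℝ Set.univ φ) (y : Label) (u v : ℝ) {a b : ℝ}
    (ha : 0 ≤ a) (hb : 0 ≤ b) (hab : a + b = 1) :
    loss φ (a * u + b * v) y ≤ a * loss φ u y + b * loss φ v y := by
  have := hc.2 (Set.mem_univ (y * u)) (Set.mem_univ (y * v)) ha hb hab
  simp only [smul_eq_mul] at this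
  rw [loss, show (y : ℝ) * (a * u + b * v) = a * (y * u) + b * (y * v) by ring]
  exact this

theorem abs_loss_sub_le (hφ : Differentiable ℝ φ) {M : ℝ}
    (hM : ∀ (ζ : ℝ) (y : Label), |dloss φ ζ y| ≤ M) (u v : ℝ) (y : Label) :
    |loss φ u y - loss φ v y| ≤ M * |u - v| := by
  have hd : Differentiable ℝ fun ζ => loss φ ζ y := by
    unfold loss
    fun_prop
  simpa only [Real.norm_eq_abs] using
    convex_univ.norm_image_sub_le_of_norm_deriv_le (f := fun ζ => loss φ ζ y) (C := M)
      (fun x _ => hd x) (fun x _ => hM x y) (Set.mem_univ v) (Set.mem_univ u)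

theorem measurable_loss (hφ : Differentiable ℝ φ) {α : Type*} [MeasurableSpace α] {f : α → ℝ}
    {y : α → Label} (hf : Measurable f) (hy : Measurable y) :
    Measurable fun z => loss φ (f z) (y z) :=
  hφ.continuous.measurable.comp ((measurable_subtype_coe.comp hy).mul hf)

theorem measurable_dloss (hφ : Differentiable ℝ φ) {α : Type*} [MeasurableSpace α] {f : α → ℝ}
    {y : α → Label} (hf : Measurable f) (hy : Measurable y) :
    Measurable fun z => dloss φ (f z) (y z) := by
  simp only [dloss_eq hφ]
  exact (measurable_subtype_coe.comp hy).mul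
    ((measurable_deriv φ).comp ((measurable_subtype_coe.comp hy).mul hf))

end Loss

/-! ### Evaluation in the RKHS and the expected risk as a convex continuous functional. -/

section RKHSBasics

variable {X H : Type*} [NormedAddCommGroup H] [InnerProductSpace ℝ H] [CompleteSpace H]
  [RKHS ℝ H X ℝ]

theorem inner_feature (x : X) (g : H) : inner ℝ (feature H x) g = g x := by
  simp [feature]

theorem kern_self (x : X) : kern H x x = ‖feature H x‖ ^ 2 := by
  have h := RKHS.kernel_inner (𝕜 := ℝ) H x x (1 : ℝ) (1 : ℝ)
  rw [real_inner_self_eq_norm_sq] at h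
  rw [feature, ← h, kern]
  simp

theorem norm_feature_le {R : ℝ} (hR : 0 < R) (hkR : ∀ x : X, kern H x x ≤ R ^ 2) (x : X) :
    ‖feature H x‖ ≤ R :=
  le_of_sq_le_sq (by rw [← kern_self]; exact hkR x) hR.le

theorem abs_apply_le {R : ℝ} (hF : ∀ x : X, ‖feature H x‖ ≤ R) (g : H) (x : X) :
    |g x| ≤ R * ‖g‖ := by
  rw [← inner_feature]
  exact (abs_real_inner_le_norm _ _).trans (by gcongr; exact hF x)

theorem abs_apply_sub_le {R : ℝ} (hF : ∀ x : X, ‖feature H x‖ ≤ R) (g h : H) (x : X) :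
    |g x - h x| ≤ R * ‖g - h‖ := by
  rw [← Pi.sub_apply, ← RKHS.coe_sub]
  exact abs_apply_le hF _ _

variable [MeasurableSpace X]

theorem measurable_apply (hk : StronglyMeasurable (fun x : X => feature H x)) (g : H) :
    Measurable fun x : X => g x := by
  simp only [← inner_feature]
  exact (hk.inner stronglyMeasurable_const).measurable

/-- The expected risk `L(g) = E[l(g(X), Y)]` on `H`. -/
def risk (ρ : Measure (X × Label)) (φ : ℝ → ℝ) (g : H) : ℝ := ∫ z, loss φ (g z.1) z.2 ∂ρ

variable {ρ : Measure (X × Label)} [IsProbabilityMeasure ρ] {φ : ℝ → ℝ} {M R : ℝ}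

theorem integrable_loss (hk : StronglyMeasurable (fun x : X => feature H x))
    (hφ : Differentiable ℝ φ) (hM0 : 0 < M) (hM : ∀ (ζ : ℝ) (y : Label), |dloss φ ζ y| ≤ M)
    (hF : ∀ x : X, ‖feature H x‖ ≤ R) (g : H) :
    Integrable (fun z : X × Label => loss φ (g z.1) z.2) ρ := by
  refine Integrable.of_bound (C := |φ 0| + M * (R * ‖g‖)) (measurable_loss hφ
    ((measurable_apply hk g).comp measurable_fst) measurable_snd).aestronglyMeasurable ?_
  refine Filter.Eventually.of_forall fun z => ?_
  have h1 := abs_loss_sub_le hφ hM (g z.1) 0 z.2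
  have h2 := abs_apply_le hF g z.1
  have h3 : loss φ 0 z.2 = φ 0 := by simp [loss]
  rw [h3, sub_zero] at h1
  have h4 : M * |g z.1| ≤ M * (R * ‖g‖) := by gcongr
  have h5 := abs_sub_abs_le_abs_sub (loss φ (g z.1) z.2) (φ 0)
  rw [Real.norm_eq_abs]
  linarith

theorem convexOn_risk (hk : StronglyMeasurable (fun x : X => feature H x))
    (hφ : Differentiable ℝ φ) (hc : ConvexOn ℝ Set.univ φ) (hM0 : 0 < M)
    (hM : ∀ (ζ : ℝ) (y : Label), |dloss φ ζ y| ≤ M) (hF : ∀ x : X, ‖feature H x‖ ≤ R) :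
    ConvexOn ℝ Set.univ (risk (H := H) ρ φ) := by
  refine ⟨convex_univ, fun g _ h _ a b ha hb hab => ?_⟩
  have hi := fun g : H => integrable_loss (ρ := ρ) hk hφ hM0 hM hF g
  simp only [risk, smul_eq_mul]
  rw [← integral_const_mul, ← integral_const_mul,
    ← integral_add ((hi g).const_mul a) ((hi h).const_mul b)]
  refine integral_mono (hi _) (((hi g).const_mul a).add ((hi h).const_mul b)) fun z => ?_
  simpa using loss_convexComb_le hc z.2 (g z.1) (h z.1) ha hb hab

theorem continuous_risk (hk : StronglyMeasurable (fun x : X => feature H x))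
    (hφ : Differentiable ℝ φ) (hM0 : 0 < M) (hR0 : 0 < R)
    (hM : ∀ (ζ : ℝ) (y : Label), |dloss φ ζ y| ≤ M) (hF : ∀ x : X, ‖feature H x‖ ≤ R) :
    Continuous (risk (H := H) ρ φ) := by
  have hi := fun g : H => integrable_loss (ρ := ρ) hk hφ hM0 hM hF g
  refine (LipschitzWith.of_dist_le_mul (K := ⟨M * R, by positivity⟩) fun g h => ?_).continuous
  rw [dist_eq_norm, dist_eq_norm, risk, risk, ← integral_sub (hi g) (hi h)]
  refine (norm_integral_le_of_norm_le_const (C := M * R * ‖g - h‖)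
    (Filter.Eventually.of_forall fun z => ?_)).trans
    (by rw [probReal_univ, mul_one]; exact le_rfl)
  refine (abs_loss_sub_le hφ hM _ _ _).trans ?_
  rw [mul_assoc]
  gcongr
  exact abs_apply_sub_le hF g h z.1

theorem extRisk_eq_ofReal_risk (hφ0 : ∀ v, 0 ≤ φ v)
    (hk : StronglyMeasurable (fun x : X => feature H x))
    (hφ : Differentiable ℝ φ) (hM0 : 0 < M) (hM : ∀ (ζ : ℝ) (y : Label), |dloss φ ζ y| ≤ M)
    (hF : ∀ x : X, ‖feature H x‖ ≤ R) (g : H) :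
    extRisk ρ φ (fun x => g x) = ENNReal.ofReal (risk ρ φ g) :=
  (ofReal_integral_eq_lintegral_ofReal (integrable_loss hk hφ hM0 hM hF g)
    (Filter.Eventually.of_forall fun _ => hφ0 _)).symm

end RKHSBasics

/-! ### The link function and the margin. -/

section Link

variable {φ : ℝ → ℝ}

theorem condRisk_linkFun_le (hlink : LinkWellDefined φ) {μ : ℝ} (hμ : μ ∈ Set.Ioo (0 : ℝ) 1)
    (h : ℝ) : condRisk φ μ (linkFun φ μ) ≤ condRisk φ μ h :=
  Classical.epsilon_spec (p := fun h : ℝ => ∀ h' : ℝ, condRisk φ μ h ≤ condRisk φ μ h')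
    (hlink μ hμ).exists h

theorem eq_linkFun (hlink : LinkWellDefined φ) {μ : ℝ} (hμ : μ ∈ Set.Ioo (0 : ℝ) 1) {h : ℝ}
    (hh : condRisk φ μ h ≤ condRisk φ μ (linkFun φ μ)) : h = linkFun φ μ :=
  (hlink μ hμ).unique (fun h' => hh.trans (condRisk_linkFun_le hlink hμ h'))
    (condRisk_linkFun_le hlink hμ)

theorem condRisk_one_sub (φ : ℝ → ℝ) (μ h : ℝ) : condRisk φ (1 - μ) h = condRisk φ μ (-h) := by
  simp only [condRisk, neg_neg]
  ring

/-- Exchanging the labels reflects `h`; uniqueness of the minimizer then forces odd symmetry. In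
particular both entries of the maximum in `margin` coincide. -/
theorem linkFun_one_sub (hlink : LinkWellDefined φ) {μ : ℝ} (hμ : μ ∈ Set.Ioo (0 : ℝ) 1) :
    linkFun φ (1 - μ) = -linkFun φ μ := by
  refine (eq_linkFun hlink ⟨by linarith [hμ.2], by linarith [hμ.1]⟩ ?_).symm
  rw [condRisk_one_sub, condRisk_one_sub, neg_neg]
  exact condRisk_linkFun_le hlink hμ _

theorem linkFun_pos (hsign : ∀ μ ∈ Set.Ioo (0 : ℝ) 1,
    Real.sign (μ - 1 / 2) = Real.sign (linkFun φ μ)) {μ : ℝ} (hμ : μ ∈ Set.Ioo (0 : ℝ) 1)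
    (h : 1 / 2 < μ) : 0 < linkFun φ μ := by
  have h1 := hsign μ hμ
  rw [Real.sign_of_pos (sub_pos.2 h)] at h1
  by_contra hneg
  rcases (not_lt.1 hneg).lt_or_eq with h2 | h2
  · rw [Real.sign_of_neg h2] at h1
    norm_num at h1
  · rw [h2, Real.sign_zero] at h1
    norm_num at h1

theorem margin_eq (hlink : LinkWellDefined φ) (hsign : ∀ μ ∈ Set.Ioo (0 : ℝ) 1,
    Real.sign (μ - 1 / 2) = Real.sign (linkFun φ μ)) {δ : ℝ} (hδ : δ ∈ Set.Ioo (0 : ℝ) (1 / 2)) :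
    margin φ δ = linkFun φ (1 / 2 + δ) := by
  have hμ : 1 / 2 + δ ∈ Set.Ioo (0 : ℝ) 1 := ⟨by linarith [hδ.1], by linarith [hδ.2]⟩
  have hpos := linkFun_pos hsign hμ (by linarith [hδ.1])
  rw [margin, show (1 / 2 - δ : ℝ) = 1 - (1 / 2 + δ) by ring, linkFun_one_sub hlink hμ, abs_neg,
    abs_of_pos hpos, max_self]

theorem margin_pos (hlink : LinkWellDefined φ) (hsign : ∀ μ ∈ Set.Ioo (0 : ℝ) 1,
    Real.sign (μ - 1 / 2) = Real.sign (linkFun φ μ)) {δ : ℝ} (hδ : δ ∈ Set.Ioo (0 : ℝ) (1 / 2)) :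
    0 < margin φ δ := by
  rw [margin_eq hlink hsign hδ]
  exact linkFun_pos hsign ⟨by linarith [hδ.1], by linarith [hδ.2]⟩ (by linarith [hδ.1])

theorem margin_le_abs_linkFun (hlink : LinkWellDefined φ)
    (hmono : MonotoneOn (linkFun φ) (Set.Ioo (0 : ℝ) 1)) (hsign : ∀ μ ∈ Set.Ioo (0 : ℝ) 1,
    Real.sign (μ - 1 / 2) = Real.sign (linkFun φ μ)) {δ : ℝ} (hδ : δ ∈ Set.Ioo (0 : ℝ) (1 / 2))
    {μ : ℝ} (hμ : μ ∈ Set.Ioo (0 : ℝ) 1) (h : δ < |μ - 1 / 2|) :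
    margin φ δ ≤ |linkFun φ μ| := by
  rw [margin_eq hlink hsign hδ]
  have hμδ : 1 / 2 + δ ∈ Set.Ioo (0 : ℝ) 1 := ⟨by linarith [hδ.1], by linarith [hδ.2]⟩
  rcases lt_abs.1 h with h | h
  · exact (hmono hμδ hμ (by linarith)).trans (le_abs_self _)
  · have hμ' : 1 - μ ∈ Set.Ioo (0 : ℝ) 1 := ⟨by linarith [hμ.2], by linarith [hμ.1]⟩
    have := hmono hμδ hμ' (by linarith)
    rw [linkFun_one_sub hlink hμ] at this
    exact this.trans (neg_le_abs _)

end Link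

/-! ### Disintegration of the risk and identification of Bayes rules. -/

section BayesRule

theorem Label.integral_eq (ν : Measure Label) [IsProbabilityMeasure ν] (F : Label → ℝ) :
    ∫ y, F y ∂ν
      = ν.real {Label.one} * F Label.one + (1 - ν.real {Label.one}) * F ⟨-1, by simp⟩ := by
  classical
  have : Fintype Label := Fintype.ofFinite Label
  set n : Label := ⟨-1, by simp⟩ with hn
  have hne : Label.one ≠ n := by
    rw [hn, Label.one, Ne, Subtype.mk.injEq]
    norm_num
  have huniv : ∀ y : Label, y = Label.one ∨ y = n := fun y =>
    y.coe_eq_neg_one_or_one.symm.imp Subtype.ext Subtype.ext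
  have hcompl : ({n} : Set Label) = {Label.one}ᶜ := by
    ext y
    rcases huniv y with rfl | rfl
    · simpa using hne
    · simpa using hne.symm
  have hfin : (Finset.univ : Finset Label) = {Label.one, n} := by
    ext y
    simpa using huniv y
  rw [integral_fintype (Integrable.of_finite), hfin, Finset.sum_pair hne, hcompl,
    probReal_compl_eq_one_sub (MeasurableSet.singleton _)]
  simp

variable {X : Type*} [MeasurableSpace X] {ρ : Measure (X × Label)} [IsProbabilityMeasure ρ]
  {φ : ℝ → ℝ}

theorem measurable_condProb : Measurable (condProb ρ) :=
  (Kernel.measurable_coe _ (MeasurableSet.singleton _)).ennreal_toReal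

theorem condMean_eq (x : X) : condMean ρ x = 2 * condProb ρ x - 1 := by
  rw [condMean, Label.integral_eq, condProb]
  simp only [Label.one]
  ring

theorem extRisk_eq_lintegral_condRisk (hφ0 : ∀ v, 0 ≤ φ v) (hφ : Differentiable ℝ φ) {f : X → ℝ}
    (hf : Measurable f) :
    extRisk ρ φ f = ∫⁻ x, ENNReal.ofReal (condRisk φ (condProb ρ x) (f x)) ∂ρ.fst := by
  have hm : Measurable fun z : X × Label => ENNReal.ofReal (loss φ (f z.1) z.2) :=
    (measurable_loss hφ (hf.comp measurable_fst) measurable_snd).ennreal_ofReal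
  rw [extRisk, ← Measure.lintegral_condKernel hm]
  refine lintegral_congr fun x => ?_
  rw [← ofReal_integral_eq_lintegral_ofReal (f := fun y => loss φ (f x) y) Integrable.of_finite
    (Filter.Eventually.of_forall fun _ => hφ0 _), Label.integral_eq]
  simp [condRisk, condProb, loss, Label.one]

theorem condRisk_nonneg (hφ0 : ∀ v, 0 ≤ φ v) {μ : ℝ} (hμ : μ ∈ Set.Ioo (0 : ℝ) 1) (h : ℝ) :
    0 ≤ condRisk φ μ h :=
  add_nonneg (mul_nonneg hμ.1.le (hφ0 _)) (mul_nonneg (sub_nonneg.2 hμ.2.le) (hφ0 _))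

theorem measurable_condRisk (hφ : Differentiable ℝ φ) {f : X → ℝ} (hf : Measurable f) :
    Measurable fun x => condRisk φ (condProb ρ x) (f x) := by
  have h := hφ.continuous.measurable
  exact (measurable_condProb.mul (h.comp hf)).add
    ((measurable_const.sub measurable_condProb).mul (h.comp hf.neg))

/-- A Bayes rule with finite risk is almost everywhere the link function of the conditional
probability. -/
theorem IsBayesRule.ae_eq_linkFun (hφ0 : ∀ v, 0 ≤ φ v) (hφ : Differentiable ℝ φ)
    (hprob : ∀ᵐ x ∂ρ.fst, condProb ρ x ∈ Set.Ioo (0 : ℝ) 1) (hlink : LinkWellDefined φ)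
    (hdiff : DifferentiableOn ℝ (linkFun φ) (Set.Ioo (0 : ℝ) 1)) {f : X → ℝ}
    (hf : IsBayesRule ρ φ f) (hfin : extRisk ρ φ f ≠ ⊤) :
    ∀ᵐ x ∂ρ.fst, f x = linkFun φ (condProb ρ x) := by
  classical
  -- Outside `(0, 1)` the link is an arbitrary choice; replacing it there by `0` gives a measurable
  -- competitor, which minimizes the conditional risk at almost every `x`.
  set ℓ : ℝ → ℝ := (Set.Ioo (0 : ℝ) 1).piecewise (linkFun φ) 0 with hℓ
  have hℓm : Measurable ℓ :=
    hdiff.continuousOn.measurable_piecewise continuousOn_const measurableSet_Ioo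
  have hℓc : Measurable fun x => ℓ (condProb ρ x) := hℓm.comp measurable_condProb
  have hle := hf.2 _ hℓc
  rw [extRisk_eq_lintegral_condRisk hφ0 hφ hf.1] at hle hfin
  rw [extRisk_eq_lintegral_condRisk hφ0 hφ hℓc] at hle
  have hpt : (fun x => ENNReal.ofReal (condRisk φ (condProb ρ x) (ℓ (condProb ρ x))))
      ≤ᵐ[ρ.fst] fun x => ENNReal.ofReal (condRisk φ (condProb ρ x) (f x)) := by
    filter_upwards [hprob] with x hx
    rw [hℓ, Set.piecewise_eq_of_mem _ _ _ hx]
    exact ENNReal.ofReal_le_ofReal (condRisk_linkFun_le hlink hx _)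
  -- A pointwise inequality whose integrals compare the other way is an a.e. equality, as the
  -- smaller integral is finite; uniqueness of the minimizer then identifies `f x`.
  have heq := ae_eq_of_ae_le_of_lintegral_le hpt
    (ne_top_of_le_ne_top hfin (lintegral_mono_ae hpt))
    (measurable_condRisk hφ hf.1).ennreal_ofReal.aemeasurable hle
  filter_upwards [hprob, heq] with x hx hxe
  rw [hℓ, Set.piecewise_eq_of_mem _ _ _ hx,
    ENNReal.ofReal_eq_ofReal_iff (condRisk_nonneg hφ0 hx _) (condRisk_nonneg hφ0 hx _)] at hxe
  exact eq_linkFun hlink hx hxe.ge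

end BayesRule

/-! ### The classification error depends only on signs. -/

section ClassError

variable {X : Type*} [MeasurableSpace X]

theorem zeroOne_nonneg (y y' : ℝ) : 0 ≤ zeroOne y y' := by
  unfold zeroOne; split_ifs <;> norm_num

theorem zeroOne_le_one (y y' : ℝ) : zeroOne y y' ≤ 1 := by
  unfold zeroOne; split_ifs <;> norm_num

theorem classError_nonneg (ρ : Measure (X × Label)) (f : X → ℝ) : 0 ≤ classError ρ f :=
  integral_nonneg fun _ => zeroOne_nonneg _ _

theorem classError_congr {ρ : Measure (X × Label)} {f g : X → ℝ} (h : ∀ᵐ x ∂ρ.fst, Real.sign (f x) = Real.sign (g x)) :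
    classError ρ f = classError ρ g := by
  refine integral_congr_ae ?_
  filter_upwards [ae_of_ae_map measurable_fst.aemeasurable h] with z hz
  simp only [hz]

variable {ρ : Measure (X × Label)} [IsProbabilityMeasure ρ]

theorem classError_le_one (f : X → ℝ) : classError ρ f ≤ 1 := by
  have h := norm_integral_le_of_norm_le_const (μ := ρ) (C := 1)
    (f := fun z => zeroOne (Real.sign (f z.1)) (z.2 : ℝ)) (Filter.Eventually.of_forall fun z => by
      rw [Real.norm_eq_abs, abs_of_nonneg (zeroOne_nonneg _ _)]
      exact zeroOne_le_one _ _)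
  rw [probReal_univ, mul_one] at h
  exact (le_abs_self _).trans h

theorem measurable_sign : Measurable Real.sign := by
  unfold Real.sign
  exact Measurable.ite measurableSet_Iio measurable_const
    (Measurable.ite measurableSet_Ioi measurable_const measurable_const)

theorem measurable_classError {α : Type*} [MeasurableSpace α] {f : α → X → ℝ}
    (hf : Measurable fun q : α × X => f q.1 q.2) : Measurable fun a => classError ρ (f a) := by
  have h1 : Measurable fun q : α × (X × Label) => Real.sign (f q.1 q.2.1) :=
    measurable_sign.comp (hf.comp (measurable_fst.prodMk (measurable_fst.comp measurable_snd)))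
  have h2 : Measurable fun q : α × (X × Label) => (q.2.2 : ℝ) :=
    measurable_subtype_coe.comp (measurable_snd.comp measurable_snd)
  have h3 : Measurable fun q : α × (X × Label) => zeroOne (Real.sign (f q.1 q.2.1)) (q.2.2 : ℝ) :=
    Measurable.ite (measurableSet_eq_fun h1 h2).compl measurable_const measurable_const
  exact (h3.stronglyMeasurable.integral_prod_right').measurable

theorem sign_eq_of_abs_sub_lt {a b : ℝ} (h : |a - b| < |b|) : Real.sign a = Real.sign b := by
  have h1 := abs_lt.1 h
  rcases lt_trichotomy b 0 with hb | rfl | hb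
  · rw [abs_of_neg hb] at h1
    rw [Real.sign_of_neg hb, Real.sign_of_neg (by linarith)]
  · simp at h
    exact absurd h (abs_nonneg _).not_gt
  · rw [abs_of_pos hb] at h1
    rw [Real.sign_of_pos hb, Real.sign_of_pos (by linarith)]

theorem sign_condMean {x : X} : Real.sign (condMean ρ x) = Real.sign (condProb ρ x - 1 / 2) := by
  rw [condMean_eq]
  rcases lt_trichotomy (condProb ρ x - 1 / 2) 0 with h | h | h
  · rw [Real.sign_of_neg h, Real.sign_of_neg (by linarith)]
  · rw [h, show 2 * condProb ρ x - 1 = 0 by linarith]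
  · rw [Real.sign_of_pos h, Real.sign_of_pos (by linarith)]

end ClassError

/-! ### Integrating out a fresh sample. -/

section Independence

/-- Integrating out a variable `Z k` that is independent of the finitely many `Z i`, `i ∈ s`, on
which the integrand depends otherwise. -/
theorem lintegral_comp_eq_of_iIndepFun {S Ω : Type*} [MeasurableSpace S] [MeasurableSpace Ω]
    {P : Measure Ω} [IsProbabilityMeasure P] {ρ : Measure S} {Z : ℕ → Ω → S}
    (hZ : ∀ t, Measurable (Z t)) (hind : iIndepFun Z P) (hmap : ∀ t, P.map (Z t) = ρ)
    (s : Finset ℕ) {k : ℕ} (hk : k ∉ s) {F : (ℕ → S) × S → ENNReal} (hF : Measurable F)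
    (hdep : ∀ z z' : ℕ → S, (∀ i ∈ s, z i = z' i) → ∀ x, F (z, x) = F (z', x)) :
    ∫⁻ ω, F (fun t => Z t ω, Z k ω) ∂P = ∫⁻ ω, ∫⁻ x, F (fun t => Z t ω, x) ∂ρ ∂P := by
  classical
  obtain ⟨ω₀⟩ : Nonempty Ω := nonempty_of_isProbabilityMeasure P
  -- Extends a finite block of samples to a full sequence; the fixed filler `Z k ω₀` is immaterial
  -- because `F` reads only the coordinates in `s`.
  let e : (s → S) → ℕ → S := fun u i => if h : i ∈ s then u ⟨i, h⟩ else Z k ω₀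
  have he : Measurable e := by
    refine measurable_pi_lambda _ fun i => ?_
    by_cases h : i ∈ s
    · simpa [e, h] using measurable_pi_apply (⟨i, h⟩ : s)
    · simp [e, h]
  have heq : ∀ ω x, F (fun t => Z t ω, x) = F (e (fun i : s => Z i ω), x) := by
    intro ω x
    refine hdep _ _ (fun i hi => ?_) x
    simp [e, hi]
  have hUV : IndepFun (fun ω (i : s) => Z i ω) (Z k) P := by
    have h := hind.indepFun_finset s {k} (by simpa using hk) hZ
    have hm : Measurable fun u : ({k} : Finset ℕ) → S => u ⟨k, Finset.mem_singleton_self k⟩ :=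
      measurable_pi_apply _
    exact h.comp measurable_id hm
  have hU : Measurable fun ω (i : s) => Z i ω := measurable_pi_lambda _ fun i => hZ i
  have hG : Measurable fun q : (s → S) × S => F (e q.1, q.2) :=
    hF.comp ((he.comp measurable_fst).prodMk measurable_snd)
  have hρ : IsProbabilityMeasure ρ := hmap k ▸ Measure.isProbabilityMeasure_map (hZ k).aemeasurable
  simp only [heq]
  have h1 := (indepFun_iff_map_prod_eq_prod_map_map hU.aemeasurable (hZ k).aemeasurable).1 hUV
  rw [← lintegral_map (f := fun q : (s → S) × S => F (e q.1, q.2)) hG (hU.prodMk (hZ k)), h1,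
    hmap k, lintegral_prod _ hG.aemeasurable, lintegral_map hG.lintegral_prod_right' hU]

end Independence

/-! ### One step of SGD: boundedness, descent and exponential moment. -/

section SGDSteps

variable {X H : Type*} [NormedAddCommGroup H] [InnerProductSpace ℝ H] [CompleteSpace H]
  [RKHS ℝ H X ℝ] {φ : ℝ → ℝ} {lam M R γ : ℝ}

theorem sgd_congr {η : ℕ → ℝ} {g₁ : H} {z z' : ℕ → X × Label} {n : ℕ}
    (h : ∀ i ∈ Finset.Icc 1 n, z i = z' i) : sgd φ lam η g₁ z n = sgd φ lam η g₁ z' n := by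
  induction n with
  | zero => rfl
  | succ n ih =>
    have h1 := ih fun i hi => h i (Finset.Icc_subset_Icc_right n.le_succ hi)
    simp only [sgd, h1, h (n + 1) (by simp)]

theorem stronglyMeasurable_stochGrad [MeasurableSpace X]
    (hk : StronglyMeasurable (fun x : X => feature H x)) (hφ : Differentiable ℝ φ) {α : Type*}
    [MeasurableSpace α] {g : α → H} (hg : StronglyMeasurable g) {s : α → X × Label}
    (hs : Measurable s) : StronglyMeasurable fun a => stochGrad φ lam (g a) (s a) := by
  have hf : StronglyMeasurable fun a => feature H (s a).1 :=
    hk.comp_measurable (measurable_fst.comp hs)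
  have hd : Measurable fun a => dloss φ (g a (s a).1) (s a).2 := by
    simp only [← inner_feature (H := H)]
    exact measurable_dloss hφ (hf.inner hg).measurable (measurable_snd.comp hs)
  exact (hd.stronglyMeasurable.smul hf).add (hg.const_smul lam)

theorem stronglyMeasurable_sgd [MeasurableSpace X]
    (hk : StronglyMeasurable (fun x : X => feature H x)) (hφ : Differentiable ℝ φ) (η : ℕ → ℝ)
    (g₁ : H) (n : ℕ) :
    StronglyMeasurable fun z : ℕ → X × Label => sgd φ lam η g₁ z n := by
  induction n with
  | zero => exact stronglyMeasurable_const
  | succ n ih =>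
    exact ih.sub ((stronglyMeasurable_stochGrad hk hφ ih (measurable_pi_apply _)).const_smul _)

theorem stronglyMeasurable_avgSgd [MeasurableSpace X]
    (hk : StronglyMeasurable (fun x : X => feature H x)) (hφ : Differentiable ℝ φ) (η α : ℕ → ℝ)
    (g₁ : H) (T : ℕ) :
    StronglyMeasurable fun z : ℕ → X × Label => avgSgd φ lam η α g₁ T z := by
  unfold avgSgd
  exact Finset.stronglyMeasurable_fun_sum _ fun n _ =>
    (stronglyMeasurable_sgd hk hφ η g₁ n).const_smul _

theorem norm_dloss_smul_feature_le (hM : ∀ (ζ : ℝ) (y : Label), |dloss φ ζ y| ≤ M)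
    (hF : ∀ x : X, ‖feature H x‖ ≤ R) (ζ : ℝ) (y : Label) (x : X) :
    ‖dloss φ ζ y • feature H x‖ ≤ M * R := by
  rw [norm_smul, Real.norm_eq_abs]
  exact mul_le_mul (hM _ _) (hF x) (norm_nonneg _) ((abs_nonneg _).trans (hM ζ y))

theorem norm_stochGrad_le (hlam : 0 < lam) (hM : ∀ (ζ : ℝ) (y : Label), |dloss φ ζ y| ≤ M)
    (hF : ∀ x : X, ‖feature H x‖ ≤ R) {g : H} (hg : ‖g‖ ≤ 2 * (M * R) / lam) (z : X × Label) :
    ‖stochGrad φ lam g z‖ ≤ 3 * (M * R) := by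
  refine (norm_add_le _ _).trans ?_
  have h1 := norm_dloss_smul_feature_le hM hF (g z.1) z.2 z.1
  have h2 : ‖lam • g‖ ≤ 2 * (M * R) := by
    rw [norm_smul, Real.norm_eq_abs, abs_of_pos hlam]
    rwa [le_div_iff₀' hlam] at hg
  linarith

/-- A step shrinks the iterate by `1 - lam * η` and moves it by at most `η M R`, so any ball of
radius at least `M R / lam` is invariant. -/
theorem norm_sgd_le (hlam : 0 < lam) (hM0 : 0 < M) (hR0 : 0 < R)
    (hM : ∀ (ζ : ℝ) (y : Label), |dloss φ ζ y| ≤ M) (hF : ∀ x : X, ‖feature H x‖ ≤ R)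
    {η : ℕ → ℝ} (hη0 : ∀ n, 0 ≤ η (n + 1)) (hη : ∀ n, lam * η (n + 1) ≤ 1) {g₁ : H}
    (hg₁ : ‖g₁‖ ≤ 2 * (M * R) / lam) (z : ℕ → X × Label) (n : ℕ) :
    ‖sgd φ lam η g₁ z n‖ ≤ 2 * (M * R) / lam := by
  induction n with
  | zero => exact hg₁
  | succ n ih =>
    set g := sgd φ lam η g₁ z n with hg
    set v : H := dloss φ (g (z (n + 1)).1) (z (n + 1)).2 • feature H (z (n + 1)).1 with hv
    have h1 : sgd φ lam η g₁ z (n + 1) = (1 - lam * η (n + 1)) • g - η (n + 1) • v := by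
      simp only [sgd, stochGrad, ← hg, ← hv]
      module
    have h2 : ‖v‖ ≤ M * R := norm_dloss_smul_feature_le hM hF _ _ _
    have h3 := sub_nonneg.2 (hη n)
    rw [h1]
    refine (norm_sub_le _ _).trans ?_
    rw [norm_smul, norm_smul, Real.norm_eq_abs, Real.norm_eq_abs, abs_of_nonneg h3,
      abs_of_nonneg (hη0 n)]
    have h4 : (1 - lam * η (n + 1)) * ‖g‖ ≤ (1 - lam * η (n + 1)) * (2 * (M * R) / lam) := by
      gcongr
    have h5 : η (n + 1) * ‖v‖ ≤ η (n + 1) * (M * R) := mul_le_mul_of_nonneg_left h2 (hη0 n)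
    have h6 : lam * η (n + 1) * (2 * (M * R) / lam) = 2 * (η (n + 1) * (M * R)) := by
      field_simp
    have h7 : 0 ≤ η (n + 1) * (M * R) := mul_nonneg (hη0 n) (by positivity)
    linarith

/-- The derivative of the sample loss at `g` in the direction `g - p`. -/
def lossSlope (φ : ℝ → ℝ) (p g : H) (z : X × Label) : ℝ :=
  dloss φ (g z.1) z.2 * (g z.1 - p z.1)

theorem abs_lossSlope_le (hM : ∀ (ζ : ℝ) (y : Label), |dloss φ ζ y| ≤ M)
    (hF : ∀ x : X, ‖feature H x‖ ≤ R) (p g : H) (z : X × Label) :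
    |lossSlope φ p g z| ≤ M * R * ‖g - p‖ := by
  rw [lossSlope, abs_mul, mul_assoc]
  exact mul_le_mul (hM _ _) (abs_apply_sub_le hF g p z.1) (abs_nonneg _)
    ((abs_nonneg _).trans (hM 0 z.2))

variable [MeasurableSpace X] {ρ : Measure (X × Label)} [IsProbabilityMeasure ρ]

theorem measurable_lossSlope (hk : StronglyMeasurable (fun x : X => feature H x))
    (hφ : Differentiable ℝ φ) (p g : H) : Measurable (lossSlope φ p g) :=
  (measurable_dloss hφ ((measurable_apply hk g).comp measurable_fst) measurable_snd).mul
    (((measurable_apply hk g).comp measurable_fst).sub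
      ((measurable_apply hk p).comp measurable_fst))

theorem integrable_lossSlope (hk : StronglyMeasurable (fun x : X => feature H x))
    (hφ : Differentiable ℝ φ) (hM : ∀ (ζ : ℝ) (y : Label), |dloss φ ζ y| ≤ M)
    (hF : ∀ x : X, ‖feature H x‖ ≤ R) (p g : H) : Integrable (lossSlope φ p g) ρ :=
  Integrable.of_bound (measurable_lossSlope hk hφ p g).aestronglyMeasurable (M * R * ‖g - p‖)
    (Filter.Eventually.of_forall fun z => abs_lossSlope_le hM hF p g z)

/-- Strong monotonicity of the gradient of the regularized risk, relative to its minimizer. -/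
theorem mul_norm_sq_le_integral_lossSlope (hk : StronglyMeasurable (fun x : X => feature H x))
    (hφ : Differentiable ℝ φ) (hc : ConvexOn ℝ Set.univ φ) (hM0 : 0 < M)
    (hM : ∀ (ζ : ℝ) (y : Label), |dloss φ ζ y| ≤ M) (hF : ∀ x : X, ‖feature H x‖ ≤ R) {p : H}
    (hp : ∀ g : H, risk ρ φ p + lam / 2 * ‖p‖ ^ 2 ≤ risk ρ φ g + lam / 2 * ‖g‖ ^ 2) (g : H) :
    lam * ‖g - p‖ ^ 2 ≤ (∫ z, lossSlope φ p g z ∂ρ) + lam * inner ℝ g (g - p) := by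
  have h1 := regularized_quadratic_growth (convexOn_risk (ρ := ρ) hk hφ hc hM0 hM hF) hp g
  have hi := fun g : H => integrable_loss (ρ := ρ) hk hφ hM0 hM hF g
  have h2 : risk ρ φ g - risk ρ φ p ≤ ∫ z, lossSlope φ p g z ∂ρ := by
    rw [risk, risk, ← integral_sub (hi g) (hi p)]
    refine integral_mono ((hi g).sub (hi p)) (integrable_lossSlope hk hφ hM hF p g) fun z => ?_
    have := loss_add_dloss_le hφ hc (g z.1) (p z.1) z.2
    simp only [lossSlope]
    linarith
  have h3 : inner ℝ g (g - p) = (‖g‖ ^ 2 + ‖g - p‖ ^ 2 - ‖p‖ ^ 2) / 2 := by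
    rw [norm_sub_sq_real, inner_sub_right, real_inner_self_eq_norm_sq]
    ring
  rw [h3]
  linarith

theorem norm_sq_step_le (hk : StronglyMeasurable (fun x : X => feature H x))
    (hφ : Differentiable ℝ φ) (hc : ConvexOn ℝ Set.univ φ) (hM0 : 0 < M)
    (hM : ∀ (ζ : ℝ) (y : Label), |dloss φ ζ y| ≤ M) (hF : ∀ x : X, ‖feature H x‖ ≤ R)
    (hlam : 0 < lam) {p : H}
    (hp : ∀ g : H, risk ρ φ p + lam / 2 * ‖p‖ ^ 2 ≤ risk ρ φ g + lam / 2 * ‖g‖ ^ 2) {g : H}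
    (hg : ‖g‖ ≤ 2 * (M * R) / lam) {η : ℝ} (hη : 0 ≤ η) (z : X × Label) :
    ‖g - η • stochGrad φ lam g z - p‖ ^ 2
      ≤ (1 - 2 * η * lam) * ‖g - p‖ ^ 2
        - 2 * η * (lossSlope φ p g z - ∫ z, lossSlope φ p g z ∂ρ) + 9 * η ^ 2 * (M * R) ^ 2 := by
  have h1 := mul_norm_sq_le_integral_lossSlope hk hφ hc hM0 hM hF hp g
  have h2 := norm_stochGrad_le hlam hM hF hg z
  have h3 : inner ℝ (g - p) (stochGrad φ lam g z)
      = lossSlope φ p g z + lam * inner ℝ g (g - p) := by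
    rw [real_inner_comm, stochGrad, inner_add_left, real_inner_smul_left, real_inner_smul_left,
      inner_feature, lossSlope, RKHS.coe_sub, Pi.sub_apply]
  have h4 : ‖stochGrad φ lam g z‖ ^ 2 ≤ (3 * (M * R)) ^ 2 := by gcongr
  rw [sub_right_comm, norm_sub_sq_real, real_inner_smul_right, norm_smul, mul_pow,
    Real.norm_eq_abs, sq_abs, h3]
  have h5 := mul_le_mul_of_nonneg_left h4 (sq_nonneg η)
  have h6 := mul_le_mul_of_nonneg_left h1 hη
  linarith

/-- The potential `λ² (γ + n - 1) (γ + n) a / 4` of the iterate `g_{n+1}` at squared distance `a`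
from the minimizer. -/
def potential (lam γ : ℝ) (n : ℕ) (a : ℝ) : ℝ := lam ^ 2 * (γ + n - 1) * (γ + n) / 4 * a

/-- The contraction factor is `1 - 4 / (γ + n + 1)`, which turns the weight `(γ + n)(γ + n + 1)`
into `(γ + n)(γ + n - 3)`. Compared with the old weight `(γ + n)(γ + n - 1)`, this leaves a surplus
decrease proportional to `γ + n`, exactly the averaging weight. -/
theorem potential_step_le (hk : StronglyMeasurable (fun x : X => feature H x))
    (hφ : Differentiable ℝ φ) (hc : ConvexOn ℝ Set.univ φ) (hM0 : 0 < M)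
    (hM : ∀ (ζ : ℝ) (y : Label), |dloss φ ζ y| ≤ M) (hF : ∀ x : X, ‖feature H x‖ ≤ R)
    (hlam : 0 < lam) (hγ : 3 ≤ γ) {p : H}
    (hp : ∀ g : H, risk ρ φ p + lam / 2 * ‖p‖ ^ 2 ≤ risk ρ φ g + lam / 2 * ‖g‖ ^ 2) {g : H}
    (hg : ‖g‖ ≤ 2 * (M * R) / lam) (n : ℕ) (z : X × Label) :
    potential lam γ (n + 1) (‖g - stepSize lam γ (n + 1) • stochGrad φ lam g z - p‖ ^ 2)
      ≤ potential lam γ n (‖g - p‖ ^ 2) - lam ^ 2 / 2 * (γ + n) * ‖g - p‖ ^ 2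
        - lam * (γ + n) * (lossSlope φ p g z - ∫ z, lossSlope φ p g z ∂ρ) + 9 * (M * R) ^ 2 := by
  have hn : (0 : ℝ) ≤ n := n.cast_nonneg
  have hw : 0 < γ + n + 1 := by linarith
  have hw' : 0 < γ + n := by linarith
  set η := stepSize lam γ (n + 1) with hη
  have hη' : η = 2 / (lam * (γ + n + 1)) := by rw [hη, stepSize]; push_cast; ring
  have hη0 : 0 ≤ η := by rw [hη']; positivity
  have h1 := norm_sq_step_le hk hφ hc hM0 hM hF hlam hp hg hη0 z
  set a := ‖g - p‖ ^ 2
  set a' := ‖g - η • stochGrad φ lam g z - p‖ ^ 2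
  set N := lossSlope φ p g z - ∫ z, lossSlope φ p g z ∂ρ
  set c : ℝ := lam ^ 2 * (γ + n) * (γ + n + 1) / 4 with hcdef
  have hc0 : 0 ≤ c := by positivity
  have h2 : potential lam γ (n + 1) a' = c * a' := by
    rw [potential, hcdef]; push_cast; ring
  have h3 : c * ((1 - 2 * η * lam) * a)
      = potential lam γ n a - lam ^ 2 / 2 * (γ + n) * a := by
    rw [potential, hcdef, hη']; field_simp; ring
  have h4 : c * (2 * η * N) = lam * (γ + n) * N := by
    rw [hcdef, hη']; field_simp; ring
  have h5 : c * (9 * η ^ 2 * (M * R) ^ 2) = (γ + n) / (γ + n + 1) * (9 * (M * R) ^ 2) := by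
    rw [hcdef, hη']; field_simp; ring
  have h6 : (γ + n) / (γ + n + 1) * (9 * (M * R) ^ 2) ≤ 1 * (9 * (M * R) ^ 2) := by
    gcongr
    rw [div_le_one hw]
    linarith
  have h7 := mul_le_mul_of_nonneg_left h1 hc0
  rw [h2]
  linarith

/-- The noise is bounded by a multiple of `‖g - p‖`, so Hoeffding's lemma yields a variance proxy
proportional to `‖g - p‖ ^ 2`, which the potential itself dominates. -/
theorem lintegral_exp_potential_step_le (hk : StronglyMeasurable (fun x : X => feature H x))
    (hφ : Differentiable ℝ φ) (hc : ConvexOn ℝ Set.univ φ) (hM0 : 0 < M) (hR0 : 0 < R)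
    (hM : ∀ (ζ : ℝ) (y : Label), |dloss φ ζ y| ≤ M) (hF : ∀ x : X, ‖feature H x‖ ≤ R)
    (hlam : 0 < lam) (hγ : 3 ≤ γ) {p : H}
    (hp : ∀ g : H, risk ρ φ p + lam / 2 * ‖p‖ ^ 2 ≤ risk ρ φ g + lam / 2 * ‖g‖ ^ 2) {g : H}
    (hg : ‖g‖ ≤ 2 * (M * R) / lam) (n : ℕ) {θ : ℝ} (hθ : 0 ≤ θ) :
    ∫⁻ z, ENNReal.ofReal (Real.exp (θ * potential lam γ (n + 1)
        (‖g - stepSize lam γ (n + 1) • stochGrad φ lam g z - p‖ ^ 2))) ∂ρ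
      ≤ ENNReal.ofReal (Real.exp ((θ + 3 * (M * R) ^ 2 * θ ^ 2) * potential lam γ n (‖g - p‖ ^ 2)
          - θ * (lam ^ 2 / 2 * (γ + n) * ‖g - p‖ ^ 2) + 9 * (M * R) ^ 2 * θ)) := by
  have hn : (0 : ℝ) ≤ n := n.cast_nonneg
  have hsub := hasSubgaussianMGF_of_mem_Icc (μ := ρ) (X := lossSlope φ p g)
    (a := -(M * R * ‖g - p‖)) (b := M * R * ‖g - p‖) (measurable_lossSlope hk hφ p g).aemeasurable
    (Filter.Eventually.of_forall fun z => abs_le.1 (abs_lossSlope_le hM hF p g z))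
  set t : ℝ := -(θ * lam * (γ + n)) with ht
  set A : ℝ := θ * (potential lam γ n (‖g - p‖ ^ 2) - lam ^ 2 / 2 * (γ + n) * ‖g - p‖ ^ 2
    + 9 * (M * R) ^ 2) with hA
  have hmgf := hsub.mgf_le t
  have hint := hsub.integrable_exp_mul t
  rw [mgf] at hmgf
  have hcoef : ((‖M * R * ‖g - p‖ - -(M * R * ‖g - p‖)‖₊ / 2) ^ 2 : NNReal)
      = (M * R) ^ 2 * ‖g - p‖ ^ 2 := by
    push_cast
    rw [sub_neg_eq_add, Real.norm_eq_abs, abs_of_nonneg (by positivity)]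
    ring
  have hquad : (M * R) ^ 2 * ‖g - p‖ ^ 2 * t ^ 2 / 2
      ≤ 3 * (M * R) ^ 2 * θ ^ 2 * potential lam γ n (‖g - p‖ ^ 2) := by
    -- The comparison reduces to `2 (γ + n) ≤ 3 (γ + n - 1)`, which holds since `γ ≥ 3`.
    have h1 : 0 ≤ (M * R) ^ 2 * θ ^ 2 * lam ^ 2 * ‖g - p‖ ^ 2 * (γ + n) * (γ + n - 3) := by
      have : 0 ≤ γ + n - 3 := by linarith
      have : 0 ≤ γ + n := by linarith
      positivity
    rw [ht, potential]
    linarith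
  calc ∫⁻ z, ENNReal.ofReal (Real.exp (θ * potential lam γ (n + 1)
        (‖g - stepSize lam γ (n + 1) • stochGrad φ lam g z - p‖ ^ 2))) ∂ρ
      ≤ ∫⁻ z, ENNReal.ofReal (Real.exp A
          * Real.exp (t * (lossSlope φ p g z - ∫ z, lossSlope φ p g z ∂ρ))) ∂ρ := by
        refine lintegral_mono fun z => ENNReal.ofReal_le_ofReal ?_
        rw [← Real.exp_add]
        refine Real.exp_le_exp.2 ?_
        have := mul_le_mul_of_nonneg_left
          (potential_step_le hk hφ hc hM0 hM hF hlam hγ hp hg n z) hθ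
        rw [hA, ht]
        linarith
    _ = ENNReal.ofReal (Real.exp A
          * ∫ z, Real.exp (t * (lossSlope φ p g z - ∫ z, lossSlope φ p g z ∂ρ)) ∂ρ) := by
        rw [← integral_const_mul, ofReal_integral_eq_lintegral_ofReal (hint.const_mul _)
          (Filter.Eventually.of_forall fun _ => by positivity)]
    _ ≤ _ := by
        refine ENNReal.ofReal_le_ofReal ?_
        refine (mul_le_mul_of_nonneg_left hmgf (Real.exp_pos A).le).trans ?_
        rw [← Real.exp_add, hcoef]
        refine Real.exp_le_exp.2 ?_
        rw [hA]
        linarith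

end SGDSteps

/-! ### Averaging weights and Jensen's inequality. -/

section Average

variable {lam γ : ℝ}

theorem sum_range_add_cast (γ : ℝ) (T : ℕ) :
    ∑ n ∈ Finset.range (T + 1), (γ + n) = (2 * γ + T) * (T + 1) / 2 := by
  induction T with
  | zero => simp
  | succ T ih =>
    rw [Finset.sum_range_succ, ih]
    push_cast
    ring

theorem avgWeight_succ (γ : ℝ) (T n : ℕ) :
    avgWeight γ T (n + 1) = 2 * (γ + n) / ((2 * γ + T) * (T + 1)) := by
  rw [avgWeight]
  push_cast
  ring

theorem sum_avgWeight (hγ : 0 < γ) (T : ℕ) :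
    ∑ n ∈ Finset.range (T + 1), avgWeight γ T (n + 1) = 1 := by
  simp only [avgWeight_succ]
  rw [← Finset.sum_div, ← Finset.mul_sum, sum_range_add_cast]
  have : 0 < 2 * γ + T := by positivity
  field_simp

variable {X H : Type*} [NormedAddCommGroup H] [InnerProductSpace ℝ H] [CompleteSpace H]
  [RKHS ℝ H X ℝ] {φ : ℝ → ℝ}

theorem norm_sq_avgSgd_sub_le (hγ : 0 < γ) (η : ℕ → ℝ) (g₁ p : H) (T : ℕ) (z : ℕ → X × Label) :
    (2 * γ + T) * (T + 1) / 2 * ‖avgSgd φ lam η (avgWeight γ T) g₁ T z - p‖ ^ 2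
      ≤ ∑ n ∈ Finset.range (T + 1), (γ + n) * ‖sgd φ lam η g₁ z n - p‖ ^ 2 := by
  have hN : 0 < 2 * γ + T := by positivity
  have hsum := sum_avgWeight hγ T
  have h1 : avgSgd φ lam η (avgWeight γ T) g₁ T z - p
      = ∑ n ∈ Finset.range (T + 1), avgWeight γ T (n + 1) • (sgd φ lam η g₁ z n - p) := by
    simp only [smul_sub, Finset.sum_sub_distrib, ← Finset.sum_smul, hsum, one_smul, avgSgd]
  have hconv : ConvexOn ℝ Set.univ fun g : H => ‖g‖ ^ 2 :=
    (convexOn_norm convex_univ).pow (fun _ _ => norm_nonneg _) 2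
  have h2 := hconv.map_sum_le (t := Finset.range (T + 1))
    (w := fun n => avgWeight γ T (n + 1)) (p := fun n => sgd φ lam η g₁ z n - p)
    (fun n _ => by rw [avgWeight_succ]; positivity) hsum (fun _ _ => Set.mem_univ _)
  rw [h1]
  refine (mul_le_mul_of_nonneg_left h2 (by positivity)).trans (le_of_eq ?_)
  rw [Finset.mul_sum]
  refine Finset.sum_congr rfl fun n _ => ?_
  rw [avgWeight_succ, smul_eq_mul]
  field_simp

end Average

/-! ### Exponential tail bound for the averaged iterate. -/

section Tail

variable {X H : Type*} [MeasurableSpace X] [NormedAddCommGroup H] [InnerProductSpace ℝ H]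
  [CompleteSpace H] [RKHS ℝ H X ℝ] {φ : ℝ → ℝ} {lam M R γ : ℝ}
  {ρ : Measure (X × Label)} [IsProbabilityMeasure ρ]
  {Ω : Type*} [MeasurableSpace Ω] {P : Measure Ω} [IsProbabilityMeasure P] {Z : ℕ → Ω → X × Label}

/-- The exponential moment of the potential of the current iterate, with decreasing parameters
`θ n`, plus the accumulated weighted squared distances of the previous iterates. -/
theorem lintegral_exp_potential_add_sum_le
    (hk : StronglyMeasurable (fun x : X => feature H x))
    (hφ : Differentiable ℝ φ) (hc : ConvexOn ℝ Set.univ φ) (hM0 : 0 < M) (hR0 : 0 < R)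
    (hM : ∀ (ζ : ℝ) (y : Label), |dloss φ ζ y| ≤ M) (hF : ∀ x : X, ‖feature H x‖ ≤ R)
    (hlam : 0 < lam) (hγ : 3 ≤ γ) {p : H}
    (hp : ∀ g : H, risk ρ φ p + lam / 2 * ‖p‖ ^ 2 ≤ risk ρ φ g + lam / 2 * ‖g‖ ^ 2) {g₁ : H}
    (hb : ∀ z n, ‖sgd φ lam (stepSize lam γ) g₁ z n‖ ≤ 2 * (M * R) / lam)
    (hZ : ∀ t, Measurable (Z t)) (hind : iIndepFun Z P) (hmap : ∀ t, P.map (Z t) = ρ)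
    {K : ℕ} {θ : ℕ → ℝ} {κ : ℝ} (hκ : 0 ≤ κ) (hκθ : ∀ n < K, κ ≤ θ (n + 1))
    (hθ : ∀ n < K, θ (n + 1) + 3 * (M * R) ^ 2 * θ (n + 1) ^ 2 ≤ θ n) {B : ℝ}
    (hB : ∀ n < K, 9 * (M * R) ^ 2 * θ (n + 1) ≤ B) {n : ℕ} (hnK : n ≤ K) :
    ∫⁻ ω, ENNReal.ofReal (Real.exp (θ n * potential lam γ n
        (‖sgd φ lam (stepSize lam γ) g₁ (fun t => Z t ω) n - p‖ ^ 2)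
        + κ * ∑ i ∈ Finset.range n, lam ^ 2 / 2 * (γ + i)
          * ‖sgd φ lam (stepSize lam γ) g₁ (fun t => Z t ω) i - p‖ ^ 2)) ∂P
      ≤ ENNReal.ofReal (Real.exp (θ 0 * potential lam γ 0 (‖g₁ - p‖ ^ 2) + n * B)) := by
  induction n with
  | zero => simp [sgd]
  | succ n ih =>
    replace ih := ih (Nat.le_of_succ_le hnK)
    set G : (ℕ → X × Label) → ℕ → H := sgd φ lam (stepSize lam γ) g₁ with hG
    set D : (ℕ → X × Label) → ℝ := fun z => κ * ∑ i ∈ Finset.range (n + 1),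
      lam ^ 2 / 2 * (γ + i) * ‖G z i - p‖ ^ 2 with hD
    set F : (ℕ → X × Label) × (X × Label) → ENNReal := fun q =>
      ENNReal.ofReal (Real.exp (θ (n + 1) * potential lam γ (n + 1)
        (‖G q.1 n - stepSize lam γ (n + 1) • stochGrad φ lam (G q.1 n) q.2 - p‖ ^ 2) + D q.1))
      with hFdef
    have hGm : ∀ i, StronglyMeasurable fun z => G z i := fun i =>
      stronglyMeasurable_sgd hk hφ _ g₁ i
    have hDm : Measurable D := by
      refine Measurable.const_mul (Finset.measurable_fun_sum _ fun i _ => ?_) κ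
      exact (((hGm i).sub stronglyMeasurable_const).norm.measurable.pow_const 2).const_mul _
    have hFm : Measurable F := by
      have h1 : StronglyMeasurable fun q : (ℕ → X × Label) × (X × Label) => G q.1 n :=
        (hGm n).comp_measurable measurable_fst
      have h2 := ((h1.sub ((stronglyMeasurable_stochGrad (lam := lam) hk hφ h1
        measurable_snd).const_smul (stepSize lam γ (n + 1)))).sub
          (stronglyMeasurable_const (b := p))).norm.measurable.pow_const 2
      exact ((((h2.const_mul _).const_mul _).add (hDm.comp measurable_fst)).exp).ennreal_ofReal
    -- After `n` steps the iterate has read only samples `1, …, n`; sample `0` is never used, and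
    -- sample `n + 1` is fresh.
    have hstep := lintegral_comp_eq_of_iIndepFun hZ hind hmap (Finset.Icc 1 n) (k := n + 1)
      (by simp) hFm (by
        intro z z' h x
        have hc : ∀ i ≤ n, G z i = G z' i := fun i hi =>
          sgd_congr fun j hj => h j (Finset.Icc_subset_Icc_right hi hj)
        have hDc : D z = D z' := by
          simp only [hD]
          congr 1
          refine Finset.sum_congr rfl fun i hi => ?_
          rw [hc i (Nat.lt_succ_iff.1 (Finset.mem_range.1 hi))]
        simp only [hFdef, hc n le_rfl, hDc])
    have hgoal : ∀ ω, ENNReal.ofReal (Real.exp (θ (n + 1) * potential lam γ (n + 1)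
        (‖G (fun t => Z t ω) (n + 1) - p‖ ^ 2) + κ * ∑ i ∈ Finset.range (n + 1),
          lam ^ 2 / 2 * (γ + i) * ‖G (fun t => Z t ω) i - p‖ ^ 2))
        = F (fun t => Z t ω, Z (n + 1) ω) := fun ω => rfl
    simp only [hgoal]
    rw [hstep]
    have hinner : ∀ z, ∫⁻ x, F (z, x) ∂ρ ≤ ENNReal.ofReal (Real.exp B)
        * ENNReal.ofReal (Real.exp (θ n * potential lam γ n (‖G z n - p‖ ^ 2)
          + κ * ∑ i ∈ Finset.range n, lam ^ 2 / 2 * (γ + i) * ‖G z i - p‖ ^ 2)) := by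
      intro z
      have h1 := lintegral_exp_potential_step_le hk hφ hc hM0 hR0 hM hF hlam hγ hp (hb z n) n
        (hκ.trans (hκθ n hnK))
      have h2 : ∫⁻ x, F (z, x) ∂ρ = ENNReal.ofReal (Real.exp (D z)) *
          ∫⁻ x, ENNReal.ofReal (Real.exp (θ (n + 1) * potential lam γ (n + 1)
            (‖G z n - stepSize lam γ (n + 1) • stochGrad φ lam (G z n) x - p‖ ^ 2))) ∂ρ := by
        rw [← lintegral_const_mul' _ _ ENNReal.ofReal_ne_top]
        refine lintegral_congr fun x => ?_
        rw [← ENNReal.ofReal_mul (Real.exp_pos _).le, ← Real.exp_add, add_comm (D z)]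
      rw [h2]
      refine (mul_le_mul_right h1 _).trans ?_
      rw [← ENNReal.ofReal_mul (Real.exp_pos _).le, ← ENNReal.ofReal_mul (Real.exp_pos _).le,
        ← Real.exp_add, ← Real.exp_add]
      refine ENNReal.ofReal_le_ofReal (Real.exp_le_exp.2 ?_)
      have hnn : (0 : ℝ) ≤ n := n.cast_nonneg
      have hγn : 0 ≤ γ + n - 1 := by linarith
      have hγn' : 0 ≤ γ + n := by linarith
      have h3 : 0 ≤ potential lam γ n (‖G z n - p‖ ^ 2) := by
        rw [potential]; positivity
      -- The drop from `θ n` to `θ (n + 1)` pays for the noise; below, `κ ≤ θ (n + 1)` lets the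
      -- surplus decrease pay for the new summand.
      have h4 := mul_le_mul_of_nonneg_right (hθ n hnK) h3
      have h5 : 0 ≤ lam ^ 2 / 2 * (γ + n) * ‖G z n - p‖ ^ 2 := by positivity
      have h6 := mul_le_mul_of_nonneg_right (hκθ n hnK) h5
      have h7 := hB n hnK
      simp only [hD]
      rw [Finset.sum_range_succ]
      linarith
    refine (lintegral_mono fun ω => hinner _).trans ?_
    rw [lintegral_const_mul' _ _ ENNReal.ofReal_ne_top]
    refine (mul_le_mul_right ih _).trans ?_
    rw [← ENNReal.ofReal_mul (Real.exp_pos _).le, ← Real.exp_add]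
    refine ENNReal.ofReal_le_ofReal (Real.exp_le_exp.2 ?_)
    push_cast
    linarith

/-- Exponential tail of the distance of averaged SGD from the minimizer of the regularized risk. -/
theorem measureReal_le_norm_avgSgd_sub_le
    (hk : StronglyMeasurable (fun x : X => feature H x))
    (hφ : Differentiable ℝ φ) (hc : ConvexOn ℝ Set.univ φ) (hM0 : 0 < M) (hR0 : 0 < R)
    (hM : ∀ (ζ : ℝ) (y : Label), |dloss φ ζ y| ≤ M) (hF : ∀ x : X, ‖feature H x‖ ≤ R)
    (hlam : 0 < lam) (hγ : 3 ≤ γ) {p : H}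
    (hp : ∀ g : H, risk ρ φ p + lam / 2 * ‖p‖ ^ 2 ≤ risk ρ φ g + lam / 2 * ‖g‖ ^ 2) {g₁ : H}
    (hg₁ : ‖g₁‖ ≤ 2 * (M * R) / lam)
    (hZ : ∀ t, Measurable (Z t)) (hind : iIndepFun Z P) (hmap : ∀ t, P.map (Z t) = ρ)
    (T : ℕ) {r : ℝ} (hr : 0 ≤ r) :
    P.real {ω | r ≤ ‖avgSgd φ lam (stepSize lam γ) (avgWeight γ T) g₁ T (fun t => Z t ω) - p‖}
      ≤ Real.exp (lam ^ 2 * (γ * (γ - 1)) * ‖g₁ - p‖ ^ 2 / (12 * (M * R) ^ 2 * (T + 1)) + 3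
          - lam ^ 2 * (2 * γ + T) * r ^ 2 / (24 * (M * R) ^ 2)) := by
  have hη0 : ∀ n, 0 ≤ stepSize lam γ (n + 1) := by
    intro n
    rw [stepSize]
    positivity
  have hη : ∀ n, lam * stepSize lam γ (n + 1) ≤ 1 := by
    intro n
    have hn : (0 : ℝ) ≤ n := n.cast_nonneg
    rw [stepSize, mul_div_assoc', mul_div_mul_left _ _ hlam.ne', div_le_one (by positivity)]
    push_cast
    linarith
  have hb := norm_sgd_le (φ := φ) hlam hM0 hR0 hM hF hη0 hη hg₁
  set c : ℝ := (M * R) ^ 2 with hcdef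
  have hc0 : 0 < c := by positivity
  have hT : (0 : ℝ) < T + 1 := by positivity
  -- With `x = T + n + 1`, the recursion becomes `x (x + 2) ≤ (x + 1) ^ 2`. Starting the
  -- denominators at `T + 1` keeps all parameters within a factor 2, so `κ`, the last value `θ (T +
  -- 1)`, is half of `θ 0`; the drift over `T + 1` steps totals at most 3.
  set θ : ℕ → ℝ := fun n => 1 / (3 * c * (T + n + 1)) with hθdef
  set κ : ℝ := 1 / (6 * c * (T + 1)) with hκdef
  have hmain := lintegral_exp_potential_add_sum_le hk hφ hc hM0 hR0 hM hF hlam hγ hp hb hZ hind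
    hmap (K := T + 1) (θ := θ) (κ := κ) (B := 3 / (T + 1)) (by positivity)
    (by
      intro n hn
      have hn' : (n : ℝ) + 1 ≤ T + 1 := by exact_mod_cast hn
      simp only [hθdef, hκdef]
      push_cast
      refine one_div_le_one_div_of_le (by positivity) ?_
      have := mul_le_mul_of_nonneg_left hn' hc0.le
      linarith)
    (by
      intro n _
      simp only [hθdef, ← hcdef]
      push_cast
      set x : ℝ := T + n + 1 with hx
      have hx0 : 0 < x := by positivity
      rw [show (T : ℝ) + (n + 1) + 1 = x + 1 by rw [hx]; ring]
      have h1 : 1 / (3 * c * (x + 1)) + 3 * c * (1 / (3 * c * (x + 1))) ^ 2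
          = (x + 2) / (3 * c * (x + 1) ^ 2) := by
        field_simp
        ring
      rw [h1, div_le_div_iff₀ (by positivity) (by positivity)]
      have : 0 ≤ 3 * c := by positivity
      linarith)
    (by
      intro n _
      simp only [hθdef, ← hcdef]
      push_cast
      rw [mul_one_div, div_le_div_iff₀ (by positivity) hT]
      have : 0 ≤ c * n := by positivity
      linarith)
    le_rfl
  set G : (ℕ → X × Label) → ℕ → H := sgd φ lam (stepSize lam γ) g₁ with hG
  set E : Set Ω :=
    {ω | r ≤ ‖avgSgd φ lam (stepSize lam γ) (avgWeight γ T) g₁ T (fun t => Z t ω) - p‖} with hE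
  have hEm : MeasurableSet E := by
    have hav := (stronglyMeasurable_avgSgd (lam := lam) hk hφ (stepSize lam γ) (avgWeight γ T) g₁
      T).comp_measurable (measurable_pi_lambda (fun ω t => Z t ω) hZ)
    exact measurableSet_le measurable_const (hav.sub stronglyMeasurable_const).norm.measurable
  set A : ℝ := lam ^ 2 * (2 * γ + T) * r ^ 2 / (24 * c) with hA
  have hlow : ∀ ω ∈ E, ENNReal.ofReal (Real.exp A) ≤ ENNReal.ofReal (Real.exp (θ (T + 1)
      * potential lam γ (T + 1) (‖G (fun t => Z t ω) (T + 1) - p‖ ^ 2)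
      + κ * ∑ i ∈ Finset.range (T + 1), lam ^ 2 / 2 * (γ + i)
        * ‖G (fun t => Z t ω) i - p‖ ^ 2)) := by
    intro ω hω
    refine ENNReal.ofReal_le_ofReal (Real.exp_le_exp.2 ?_)
    have h1 := norm_sq_avgSgd_sub_le (lam := lam) (φ := φ) (by linarith : 0 < γ)
      (stepSize lam γ) g₁ p T (fun t => Z t ω)
    have h2 : (2 * γ + T) * (T + 1) / 2 * r ^ 2 ≤ (2 * γ + T) * (T + 1) / 2
        * ‖avgSgd φ lam (stepSize lam γ) (avgWeight γ T) g₁ T (fun t => Z t ω) - p‖ ^ 2 := by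
      have : (0 : ℝ) ≤ (2 * γ + T) * (T + 1) / 2 := by positivity
      have h3 : r ≤ _ := hω
      gcongr
    have h4 : A = κ * (lam ^ 2 / 2) * ((2 * γ + T) * (T + 1) / 2 * r ^ 2) := by
      rw [hA, hκdef]
      field_simp
      ring
    have h5 : κ * ∑ i ∈ Finset.range (T + 1), lam ^ 2 / 2 * (γ + i)
        * ‖G (fun t => Z t ω) i - p‖ ^ 2
        = κ * (lam ^ 2 / 2) * ∑ i ∈ Finset.range (T + 1), (γ + i)
          * ‖G (fun t => Z t ω) i - p‖ ^ 2 := by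
      simp only [Finset.mul_sum, mul_assoc]
    have h6 : 0 ≤ θ (T + 1)
        * potential lam γ (T + 1) (‖G (fun t => Z t ω) (T + 1) - p‖ ^ 2) := by
      have h7 : 0 ≤ γ + ((T + 1 : ℕ) : ℝ) - 1 := by push_cast; linarith
      simp only [hθdef, potential]
      positivity
    rw [h4, h5]
    have h8 : 0 ≤ κ * (lam ^ 2 / 2) := by positivity
    have h9 := mul_le_mul_of_nonneg_left (h2.trans h1) h8
    linarith
  -- Markov's inequality: on `E` the accumulated sum alone, through Jensen, makes the exponent at
  -- least `A`.
  have hmarkov : ENNReal.ofReal (Real.exp A) * P E ≤ ENNReal.ofReal (Real.exp (θ 0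
      * potential lam γ 0 (‖g₁ - p‖ ^ 2) + (T + 1 : ℕ) * (3 / (T + 1)))) := by
    rw [← setLIntegral_const]
    exact ((setLIntegral_mono' hEm hlow).trans (setLIntegral_le_lintegral _ _)).trans hmain
  have hreal : Real.exp A * P.real E ≤ Real.exp (θ 0
      * potential lam γ 0 (‖g₁ - p‖ ^ 2) + (T + 1 : ℕ) * (3 / (T + 1))) := by
    have := ENNReal.toReal_mono ENNReal.ofReal_ne_top hmarkov
    rwa [ENNReal.toReal_mul, ENNReal.toReal_ofReal (Real.exp_pos _).le,
      ENNReal.toReal_ofReal (Real.exp_pos _).le] at this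
  have hexp : θ 0 * potential lam γ 0 (‖g₁ - p‖ ^ 2) + (T + 1 : ℕ) * (3 / (T + 1))
      = lam ^ 2 * (γ * (γ - 1)) * ‖g₁ - p‖ ^ 2 / (12 * c * (T + 1)) + 3 := by
    simp only [hθdef, potential]
    push_cast
    field_simp
    ring
  rw [hexp] at hreal
  rw [Real.exp_sub, le_div_iff₀ (Real.exp_pos _), mul_comm]
  exact hreal

end Tail

end

/-! ### Assembly of the classification bound. -/

theorem theorem2
    {X : Type*} [TopologicalSpace X] [MeasurableSpace X]
    (ρ : Measure (X × Label)) [IsProbabilityMeasure ρ]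
    {H : Type*} [NormedAddCommGroup H] [InnerProductSpace ℝ H] [CompleteSpace H] [RKHS ℝ H X ℝ]
    -- `x ↦ k(x, ·)` is a (Bochner) measurable map into `H`
    (hk : StronglyMeasurable (fun x : X => feature H x))
    (φ : ℝ → ℝ) (hφ_nonneg : ∀ v, 0 ≤ φ v)
    -- (A1)
    (hφ_diff : Differentiable ℝ φ) (hφ_conv : ConvexOn ℝ Set.univ φ)
    (M : ℝ) (hM : 0 < M) (hφ_bound : ∀ (ζ : ℝ) (y : Label), |dloss φ ζ y| ≤ M)
    -- (A2)
    (hsupp : ρ.fst.support = Set.univ)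
    (R : ℝ) (hR : 0 < R) (hkR : ∀ x : X, kern H x x ≤ R ^ 2)
    -- (A3)
    (δ : ℝ) (hδ : δ ∈ Set.Ioo (0 : ℝ) (1 / 2))
    (hnoise : ∀ᵐ x ∂ρ.fst, δ < |condProb ρ x - 1 / 2|)
    -- (A4)
    (hprob : ∀ᵐ x ∂ρ.fst, condProb ρ x ∈ Set.Ioo (0 : ℝ) 1)
    (hlink : LinkWellDefined φ)
    (hlink_diff : DifferentiableOn ℝ (linkFun φ) (Set.Ioo (0 : ℝ) 1))
    (hlink_mono : MonotoneOn (linkFun φ) (Set.Ioo (0 : ℝ) 1))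
    (hlink_inj : Set.InjOn (linkFun φ) (Set.Ioo (0 : ℝ) 1))
    (hlink_sign : ∀ μ ∈ Set.Ioo (0 : ℝ) 1, Real.sign (μ - 1 / 2) = Real.sign (linkFun φ μ))
    -- (A5)
    (hbregman : ∀ η₁ ∈ Set.Ioo (0 : ℝ) 1, ∀ η₂ ∈ Set.Ioo (0 : ℝ) 1,
      (bregman φ η₁ η₂ = 0 ↔ η₁ = η₂))
    (hbayes : ∃ gstar : H, IsBayesRule ρ φ (fun x => gstar x) ∧
      ∀ f : X → ℝ, IsBayesRule ρ φ f → f =ᵐ[ρ.fst] fun x => gstar x) :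
    ∃ lam₀ : ℝ, 0 < lam₀ ∧ ∀ lam : ℝ, 0 < lam → lam ≤ lam₀ →
      -- `glam` is the minimizer of the regularized expected risk over `H`
      ∃ glam : H, (∀ g : H, g ≠ glam → regRisk ρ φ lam glam < regRisk ρ φ lam g) ∧
        ∀ γ : ℝ, 0 < γ → stepSize lam γ 1 ≤ 1 / (2 * lam) →
        ∀ g₁ : H, ‖g₁‖ ≤ (2 * stepSize lam γ 1 + 1 / lam) * M * R →
        ∀ T : ℕ,
          max (36 * M ^ 2 * R ^ 2 / (lam ^ 2 * (2 * γ + T)))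
              (γ * (γ - 1) * ‖g₁ - glam‖ ^ 2 / ((2 * γ + T) * (T + 1)))
            ≤ margin φ δ ^ 2 / (32 * R ^ 2) →
        -- independent samples `Z 1, Z 2, …` drawn from `ρ`
        ∀ {Ω : Type*} [MeasurableSpace Ω] (P : Measure Ω) [IsProbabilityMeasure P]
          (Z : ℕ → Ω → X × Label),
          (∀ t, Measurable (Z t)) → iIndepFun Z P → (∀ t, P.map (Z t) = ρ) →
          Integrable (fun ω => classError ρ (fun x =>
              avgSgd φ lam (stepSize lam γ) (avgWeight γ T) g₁ T (fun t => Z t ω) x)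
            - classError ρ (condMean ρ)) P ∧
          ∫ ω, (classError ρ (fun x =>
              avgSgd φ lam (stepSize lam γ) (avgWeight γ T) g₁ T (fun t => Z t ω) x)
            - classError ρ (condMean ρ)) ∂P
            ≤ 2 * Real.exp (-(margin φ δ ^ 2 * lam ^ 2 * (2 * γ + T)
                / (2 ^ 10 * 9 * M ^ 2 * R ^ 4))) := by
  have hF := norm_feature_le hR hkR
  have hconv := convexOn_risk (ρ := ρ) hk hφ_diff hφ_conv hM hφ_bound hF
  have hcont := continuous_risk (ρ := ρ) hk hφ_diff hM hR hφ_bound hF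
  have hext := fun g : H => extRisk_eq_ofReal_risk (ρ := ρ) hφ_nonneg hk hφ_diff hM hφ_bound hF g
  have hrisk0 : ∀ g : H, 0 ≤ risk ρ φ g := fun g => integral_nonneg fun _ => hφ_nonneg _
  have hm := margin_pos hlink hlink_sign hδ
  obtain ⟨gstar, hgstar, -⟩ := hbayes
  have hgmin : ∀ g : H, risk ρ φ gstar ≤ risk ρ φ g := by
    intro g
    have h := hgstar.2 _ (measurable_apply hk g)
    rw [hext, hext] at h
    exact (ENNReal.ofReal_le_ofReal_iff (hrisk0 g)).1 h
  have hex : ∀ lam : ℝ, ∃ p : H, 0 < lam →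
      ∀ g : H, risk ρ φ p + lam / 2 * ‖p‖ ^ 2 ≤ risk ρ φ g + lam / 2 * ‖g‖ ^ 2 := by
    intro lam
    by_cases h : 0 < lam
    · obtain ⟨p, hp⟩ := exists_regularized_minimizer hconv hcont hrisk0 h
      exact ⟨p, fun _ => hp⟩
    · exact ⟨0, fun h' => absurd h' h⟩
  choose p hp using hex
  obtain ⟨q, hq, hqmin⟩ := exists_tendsto_regularized_minimizer hconv hcont hgmin hp
  have hqbayes : IsBayesRule ρ φ (fun x => q x) := by
    refine ⟨measurable_apply hk q, fun f hf => (?_ : _ ≤ _).trans (hgstar.2 f hf)⟩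
    rw [hext, hext]
    exact ENNReal.ofReal_le_ofReal hqmin
  have hqlink := hqbayes.ae_eq_linkFun hφ_nonneg hφ_diff hprob hlink hlink_diff
    (by rw [hext]; exact ENNReal.ofReal_ne_top)
  have hclass : ∀ g : H, ‖g - q‖ < margin φ δ / R →
      classError ρ (fun x => g x) = classError ρ (condMean ρ) := by
    intro g hg
    refine classError_congr ?_
    filter_upwards [hqlink, hprob, hnoise] with x hx hxp hxn
    rw [sign_condMean, hlink_sign _ hxp, ← hx]
    refine sign_eq_of_abs_sub_lt ?_
    rw [hx]
    refine lt_of_lt_of_le ?_ (margin_le_abs_linkFun hlink hlink_mono hlink_sign hδ hxp hxn)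
    rw [← hx]
    refine (abs_apply_sub_le hF g q x).trans_lt ?_
    rwa [lt_div_iff₀' hR] at hg
  -- Half of the admissible radius `m(δ)/R` goes to the regularization bias, half to the SGD error.
  have hmR : 0 < margin φ δ / (2 * R) := by positivity
  obtain ⟨lam₀, hlam₀, hsub⟩ := mem_nhdsGT_iff_exists_Ioc_subset.1
    (hq (Metric.ball_mem_nhds q hmR))
  refine ⟨lam₀, hlam₀, fun lam hlam hle => ⟨p lam, ?_, ?_⟩⟩
  · intro g hg
    have h1 := regularized_quadratic_growth hconv (hp lam hlam) g
    have h2 : 0 < lam / 2 * ‖g - p lam‖ ^ 2 := by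
      have := norm_pos_iff.2 (sub_ne_zero.2 hg)
      positivity
    simp only [regRisk]
    simp only [risk] at h1
    linarith
  intro γ hγ0 hstep g₁ hg₁ T hT Ω _ P _ Z hZ hind hmap
  -- This is the condition `η₁ ≤ 1 / (2λ)` rewritten.
  have hγ : 3 ≤ γ := by
    rw [stepSize, div_le_div_iff₀ (by positivity) (by positivity)] at hstep
    push_cast at hstep
    have : lam * 4 ≤ lam * (γ + 1) := by linarith
    linarith [le_of_mul_le_mul_left this hlam]
  have hg₁' : ‖g₁‖ ≤ 2 * (M * R) / lam := by
    refine hg₁.trans ?_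
    have h1 : 2 * stepSize lam γ 1 + 1 / lam ≤ 2 / lam := by
      have h2 : 2 * (1 / (2 * lam)) + 1 / lam = 2 / lam := by
        field_simp
        norm_num
      linarith
    have h3 := mul_le_mul_of_nonneg_right h1 (by positivity : 0 ≤ M * R)
    calc _ = (2 * stepSize lam γ 1 + 1 / lam) * (M * R) := by ring
      _ ≤ 2 / lam * (M * R) := h3
      _ = _ := by ring
  set avg : Ω → H := fun ω =>
    avgSgd φ lam (stepSize lam γ) (avgWeight γ T) g₁ T (fun t => Z t ω) with havg
  have havgm : StronglyMeasurable avg :=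
    (stronglyMeasurable_avgSgd (lam := lam) hk hφ_diff (stepSize lam γ) (avgWeight γ T) g₁
      T).comp_measurable (measurable_pi_lambda (fun ω t => Z t ω) hZ)
  have herrm : Measurable fun ω => classError ρ (fun x => avg ω x) := by
    refine measurable_classError ?_
    simp only [← inner_feature (H := H)]
    exact ((hk.comp_measurable measurable_snd).inner
      (havgm.comp_measurable measurable_fst)).measurable
  set excess : Ω → ℝ := fun ω => classError ρ (fun x => avg ω x) - classError ρ (condMean ρ)
    with hexcess
  have hint : Integrable excess P := by
    refine Integrable.of_bound (herrm.sub_const _).aestronglyMeasurable 1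
      (Filter.Eventually.of_forall fun ω => ?_)
    rw [Real.norm_eq_abs, abs_le]
    have h1 := classError_nonneg ρ fun x => avg ω x
    have h2 := classError_le_one (ρ := ρ) fun x => avg ω x
    have h3 := classError_nonneg ρ (condMean ρ)
    have h4 := classError_le_one (ρ := ρ) (condMean ρ)
    constructor <;> linarith
  refine ⟨hint, ?_⟩
  set E : Set Ω := {ω | margin φ δ / (2 * R) ≤ ‖avg ω - p lam‖} with hE
  have hEm : MeasurableSet E :=
    measurableSet_le measurable_const (havgm.sub stronglyMeasurable_const).norm.measurable
  have hpt : ∀ ω, excess ω ≤ E.indicator 1 ω := by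
    intro ω
    by_cases hω : ω ∈ E
    · rw [Set.indicator_of_mem hω, Pi.one_apply]
      have h2 := classError_le_one (ρ := ρ) fun x => avg ω x
      have h3 := classError_nonneg ρ (condMean ρ)
      simp only [hexcess]
      linarith
    · rw [Set.indicator_of_notMem hω]
      have h1 : ‖avg ω - p lam‖ < margin φ δ / (2 * R) := not_le.1 hω
      have h2 : dist (p lam) q < margin φ δ / (2 * R) := hsub ⟨hlam, hle⟩
      rw [dist_eq_norm] at h2
      have h3 : ‖avg ω - q‖ < margin φ δ / R := by
        have h4 := norm_sub_le_norm_sub_add_norm_sub (avg ω) (p lam) q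
        have h5 : margin φ δ / R = margin φ δ / (2 * R) + margin φ δ / (2 * R) := by
          field_simp
          ring
        linarith
      exact (sub_eq_zero.2 (hclass (avg ω) h3)).le
  have htail := measureReal_le_norm_avgSgd_sub_le hk hφ_diff hφ_conv hM hR hφ_bound hF hlam hγ
    (hp lam hlam) hg₁' hZ hind hmap T hmR.le
  have hbound : ∫ ω, excess ω ∂P ≤ P.real E := by
    rw [← integral_indicator_one hEm]
    exact integral_mono hint ((integrable_const (1 : ℝ)).indicator hEm) hpt
  refine (hbound.trans htail).trans ?_
  have hN : 0 < 2 * γ + T := by positivity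
  have hT1 : (0 : ℝ) < T + 1 := by positivity
  -- In this unit the two size conditions bound the constant `3` and the initial-distance term by `u
  -- / 384` each (`36 * 32 = 3 * 384`), against a decay of `u / 96`. The exponent is thus at most
  -- `-u / 192`, well below the required `-u / 9216`.
  set u : ℝ := margin φ δ ^ 2 * lam ^ 2 * (2 * γ + T) / (M ^ 2 * R ^ 4) with hu
  have hu0 : 0 ≤ u := by positivity
  have hA1 : 3 ≤ u / 384 := by
    have h1 := (le_max_left _ _).trans hT
    rw [div_le_div_iff₀ (by positivity) (by positivity)] at h1
    rw [hu, div_div, le_div_iff₀ (by positivity)]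
    linarith
  have hA2 : lam ^ 2 * (γ * (γ - 1)) * ‖g₁ - p lam‖ ^ 2 / (12 * (M * R) ^ 2 * (T + 1))
      ≤ u / 384 := by
    have h1 := (le_max_right _ _).trans hT
    have h2 : 0 ≤ lam ^ 2 * (2 * γ + T) / (12 * (M * R) ^ 2) := by positivity
    have h3 := mul_le_mul_of_nonneg_left h1 h2
    calc _ = lam ^ 2 * (2 * γ + T) / (12 * (M * R) ^ 2)
          * (γ * (γ - 1) * ‖g₁ - p lam‖ ^ 2 / ((2 * γ + T) * (T + 1))) := by field_simp
      _ ≤ _ := h3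
      _ = _ := by rw [hu]; field_simp; norm_num
  have hA3 : lam ^ 2 * (2 * γ + T) * (margin φ δ / (2 * R)) ^ 2 / (24 * (M * R) ^ 2)
      = u / 96 := by
    rw [hu]
    field_simp
    norm_num
  have hA4 : margin φ δ ^ 2 * lam ^ 2 * (2 * γ + T) / (2 ^ 10 * 9 * M ^ 2 * R ^ 4)
      = u / 9216 := by
    rw [hu]
    field_simp
    norm_num
  rw [hA3, hA4]
  have h5 : Real.exp (lam ^ 2 * (γ * (γ - 1)) * ‖g₁ - p lam‖ ^ 2 / (12 * (M * R) ^ 2 * (T + 1))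
      + 3 - u / 96) ≤ Real.exp (-(u / 9216)) := Real.exp_le_exp.2 (by linarith)
  linarith [Real.exp_pos (-(u / 9216))]
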